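/- Fix a real constant $c\ge 1$. **Images.** A pixel is an element of $\{1,\dots,n\}^2$, and an $n\times n$ grayscale image $M$ assigns to every pixel $p$ a value $M(p)\in[0,1]$. Two different pixels are adjacent if each of their coordinates differs by at most $1$. The gradient of $p$ in $M$ is the maximum of $|M(p)-M(q)|$ over the pixels $q$ adjacent to $p$. The perimeter size $P_M$ is the sum of the gradients of all pixels, where the gradient of each outermost pixel (one with a coordinate equal to $1$ or $n$) is counted as $1$. **Transformations.** Let $\bar A$ be the set of affine maps $\bar T(x)=Ax+t$ of $\mathbb R^2$ with $\|v\|/c\le\|Av\|\le c\|v\|$ for all $v\in\mathbb R^2$. The image-affine transformation based on $\bar T$ is $T(p)=\lfloor Ap+t\rfloor$ (coordinatewise). Let $\overline{\mathcal{BC}}$ be the set of intensity transformations $L(v)=\max(0,\min(1,\mathrm{con}\cdot v+\mathrm{bri}))$ with $\mathrm{con}\in[1/c,c]$ and $\mathrm{bri}\in[-c,1]$. For $T$ based on an element of $\bar A$, for $L\in\overline{\mathcal{BC}}$ and for images $M_1,M_2$ let $$\Delta_{T,L}(M_1,M_2)=\frac1{n^2}\Big(|\{p: T(p)\notin\{1,\dots,n\}^2\}|+\sum_{p:\,T(p)\in\{1,\dots,n\}^2}|M_1(p)-L(M_2(T(p)))|\Big),$$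 and let $\Delta(M_1,M_2)$ be the minimum of $\Delta_{T,L}(M_1,M_2)$ over all such $T$ and $L$. **Covers.** A finite set $\mathcal T\subseteq\bar A$ is a $\delta n$-cover if for every $\bar A_0\in\bar A$ whose image-affine transformation maps at least one pixel to a pixel there is $\bar T\in\mathcal T$ with $\|\bar A_0(x)-\bar T(x)\|_2\le\delta n$ for all $x\in[1,n+1)^2$. A finite set $\mathcal{BC}\subseteq\overline{\mathcal{BC}}$ is a $\delta$-cover if for every $L\in\overline{\mathcal{BC}}$ there is $L'\in\mathcal{BC}$ with $|L(v)-L'(v)|\le\delta$ for all $v\in[0,1]$. Call a pair $(\mathcal T,\mathcal{BC})$ of such covers $B$-small if $|\mathcal T|\le B\max(1,\delta^{-6})$ and $|\mathcal{BC}|\le B\max(1,\delta^{-2})$. **Algorithms.** An algorithm is randomized and adaptive. It has oracle access to $M_1$ and $M_2$; one query reveals the value of one pixel of one of the two images. **Theorem.** There are constants $C$, $k\in\mathbb N$ and $B_0$, depending only on $c$, such that for every $B\ge B_0$ there is a constant $K$, depending only on $c$ and $B$, with the following property. Let $n\in\mathbb N$ and $\delta>0$ with $\delta n\ge 1$. Then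 1. there is a $B$-small pair $(\mathcal T,\mathcal{BC})$ of a $\delta n$-cover and a $\delta$-cover; 2. for every such $B$-small pair $(\mathcal T,\mathcal{BC})$, every $\epsilon>0$ and every $\eta\in(0,1)$ there is an algorithm which, on every pair $M_1,M_2$ of $n\times n$ grayscale images, always makes at most $$K\cdot\frac{1}{\epsilon^2\delta^8}\cdot\log^k\!\Big(2+\frac1{\epsilon\delta}\Big)\cdot\log\frac2\eta$$ queries, and with probability at least $1-\eta$ returns $T\in\mathcal T$ and $L\in\mathcal{BC}$ such that $$|\Delta_{T,L}(M_1,M_2)-\Delta(M_1,M_2)|\le C\Big(\frac{\delta}{n}\max(P_{M_1},P_{M_2})+\epsilon\Big).$$ -/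

import Mathlib

/-! ## Images -/

/-- The set `{1, …, n}²` of pixel coordinates. -/
noncomputable def pixels (n : ℕ) : Finset (ℤ × ℤ) :=
  Finset.Icc (1 : ℤ) n ×ˢ Finset.Icc (1 : ℤ) n

/-- A pixel of an `n × n` image. -/
abbrev Pixel (n : ℕ) : Type := {p : ℤ × ℤ // p ∈ pixels n}

/-- An `n × n` grayscale image: every pixel has a value in `[0, 1]`. -/
abbrev GrayImage (n : ℕ) : Type := Pixel n → Set.Icc (0 : ℝ) 1

/-- Two different pixels are adjacent if each coordinate differs by at most one. -/
def Pixel.Adjacent {n : ℕ} (p q : Pixel n) : Prop :=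
  p ≠ q ∧ |p.1.1 - q.1.1| ≤ 1 ∧ |p.1.2 - q.1.2| ≤ 1

/-- The outermost pixels of an `n × n` image. -/
def Pixel.Outermost {n : ℕ} (p : Pixel n) : Prop :=
  p.1.1 = 1 ∨ p.1.1 = n ∨ p.1.2 = 1 ∨ p.1.2 = n

/-- The gradient of a pixel: the largest absolute difference to an adjacent pixel. -/
noncomputable def GrayImage.gradient {n : ℕ} (M : GrayImage n) (p : Pixel n) : ℝ :=
  ⨆ q : {q : Pixel n // p.Adjacent q}, |(M p : ℝ) - (M q.1 : ℝ)|

open Classical in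
/-- The perimeter size `P_M`: the sum of the gradients of all pixels, where the gradient of an
outermost pixel is counted as `1`. -/
noncomputable def GrayImage.perimeter {n : ℕ} (M : GrayImage n) : ℝ :=
  ∑ p : Pixel n, if p.Outermost then 1 else GrayImage.gradient M p

/-! ## Affine and intensity transformations -/

/-- The Euclidean plane. -/
abbrev Plane : Type := EuclideanSpace ℝ (Fin 2)

/-- Affine self-maps of the plane, `x ↦ A x + t`. -/
abbrev PlaneAffine : Type := Plane →ᵃ[ℝ] Plane

/-- The affine maps `x ↦ A x + t` whose scaling factor is in `[1/c, c]`: for every vector `v`,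
`‖v‖ / c ≤ ‖A v‖ ≤ c ‖v‖`. -/
def affineFamily (c : ℝ) : Set PlaneAffine :=
  {T | ∀ v : Plane, ‖v‖ / c ≤ ‖T.linear v‖ ∧ ‖T.linear v‖ ≤ c * ‖v‖}

/-- The point of the plane with the coordinates of a pixel. -/
noncomputable def pixelPoint (p : ℤ × ℤ) : Plane := !₂[(p.1 : ℝ), (p.2 : ℝ)]

/-- The image-affine transformation based on `T`, namely `p ↦ ⌊A p + t⌋`. -/
noncomputable def imageAffine (T : PlaneAffine) (p : ℤ × ℤ) : ℤ × ℤ :=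
  (⌊T (pixelPoint p) 0⌋, ⌊T (pixelPoint p) 1⌋)

/-- A change of contrast and brightness. -/
structure Intensity where
  con : ℝ
  bri : ℝ

/-- The value `v` is multiplied by the contrast factor, the brightness is added, and the result
is truncated to `[0, 1]`. -/
noncomputable def Intensity.apply (L : Intensity) (v : ℝ) : ℝ :=
  max 0 (min 1 (L.con * v + L.bri))

/-- The intensity transformations with contrast in `[1/c, c]` and brightness in `[-c, 1]`. -/
def intensityFamily (c : ℝ) : Set Intensity :=
  {L | L.con ∈ Set.Icc (1 / c) c ∧ L.bri ∈ Set.Icc (-c) 1}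

/-! ## Distances between images -/

/-- `Δ_{T,L}(M₁, M₂)`: the average over the pixels `p` of `M₁` of `|M₁(p) - L(M₂(T(p)))|`, where
a pixel that is mapped out of `M₂` contributes `1`. -/
noncomputable def imageDistWith {n : ℕ} (T : PlaneAffine) (L : Intensity)
    (M₁ M₂ : GrayImage n) : ℝ :=
  (1 / (n : ℝ) ^ 2) * ∑ p : Pixel n,
    if h : imageAffine T p.1 ∈ pixels n then
      |(M₁ p : ℝ) - L.apply (M₂ ⟨imageAffine T p.1, h⟩ : ℝ)|
    else 1

/-- `Δ(M₁, M₂)`: the minimum of `Δ_{T,L}(M₁, M₂)` over all admissible `T` and `L`. -/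
noncomputable def imageDist {n : ℕ} (c : ℝ) (M₁ M₂ : GrayImage n) : ℝ :=
  sInf {d : ℝ | ∃ T ∈ affineFamily c, ∃ L ∈ intensityFamily c, d = imageDistWith T L M₁ M₂}

/-! ## Covers -/

/-- The `l^n_∞` distance of the affine maps `T`, `T'` is at most `α`: every point of
`[1, n+1)²` is mapped by them to points at Euclidean distance at most `α`. -/
def AffineClose (n : ℕ) (α : ℝ) (T T' : PlaneAffine) : Prop :=
  ∀ x : Plane, (∀ i, x i ∈ Set.Ico (1 : ℝ) (n + 1)) → dist (T x) (T' x) ≤ α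

/-- The affine map `T` is relevant for `n × n` images if its image-affine transformation maps
some pixel to a pixel. -/
def HitsImage (n : ℕ) (T : PlaneAffine) : Prop :=
  ∃ p ∈ pixels n, imageAffine T p ∈ pixels n

/-- `𝒯` is an `α`-cover of the affine family. Maps that send every pixel out of the image (their
translations are unbounded, and the distance is `1` for them) need not be covered. -/
def IsAffineCover (c : ℝ) (n : ℕ) (α : ℝ) (𝒯 : Finset PlaneAffine) : Prop :=
  (∀ T ∈ 𝒯, T ∈ affineFamily c) ∧
    ∀ A ∈ affineFamily c, HitsImage n A → ∃ T ∈ 𝒯, AffineClose n α A T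

/-- `ℬ` is an `α`-cover of the family of intensity transformations, for the maximal difference
of the values over `v ∈ [0, 1]`. -/
def IsIntensityCover (c : ℝ) (α : ℝ) (ℬ : Finset Intensity) : Prop :=
  (∀ L ∈ ℬ, L ∈ intensityFamily c) ∧
    ∀ L ∈ intensityFamily c, ∃ L' ∈ ℬ, ∀ v ∈ Set.Icc (0 : ℝ) 1, |L.apply v - L'.apply v| ≤ α

/-! ## Query algorithms -/

/-- A deterministic adaptive query algorithm with oracle access to two `n × n` images: it either
stops with an output, or it queries a pixel of one of the images (the first one if the flag is
`false`, the second one if it is `true`) and continues depending on the value that it sees. A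
randomized algorithm is a probability distribution on these. -/
inductive QueryAlg (n : ℕ) (R : Type) : Type
  | output (r : R) : QueryAlg n R
  | query (second : Bool) (p : Pixel n) (next : Set.Icc (0 : ℝ) 1 → QueryAlg n R) : QueryAlg n R

/-- The output on the images `M₁`, `M₂`. -/
def QueryAlg.run {n : ℕ} {R : Type} (M₁ M₂ : GrayImage n) : QueryAlg n R → R
  | .output r => r
  | .query second p next => (next (if second then M₂ p else M₁ p)).run M₁ M₂

/-- The number of queries made on the images `M₁`, `M₂`. -/
def QueryAlg.queryCount {n : ℕ} {R : Type} (M₁ M₂ : GrayImage n) : QueryAlg n R → ℕ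
  | .output _ => 0
  | .query second p next => (next (if second then M₂ p else M₁ p)).queryCount M₁ M₂ + 1

/-! The distance is stable under perturbing the affine map, at a cost measured by the perimeter
size. If `T` and `T'` differ by at most `δ n` on the square, interpolate linearly between them in
`⌈δ n⌉` steps. One step moves the image of each pixel by at most one in each coordinate, so after
rounding down it stays put or moves to a neighbour, and its mismatch changes by at most `c` times
the gradients involved. Leaving the image costs at most 1, which is paid by an outermost pixel; this
is why those count as 1. For small `δ` the interpolated maps still do not contract much, so each
target is hit by `O(1)` pixels and one step costs `O(P)` in total. Summing over `O(δ n)` steps and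
dividing by `n²` gives `O(δ P / n)` (`abs_imageDistWith_sub_le_of_affineClose`). As `P ≥ n`, the
error `δ` from the intensity cover is of the same order, so the covers contain an almost optimal
pair (`exists_mem_covers_imageDistWith_le`).

The best pair is found by sampling: a Chernoff bound and a union bound over all pairs
(`card_exists_sample_mean_far_le`) show that one sample of `O(ε⁻² log(|𝒯||ℬ|/η))` pixels estimates
all distances simultaneously. Evaluating it takes one query per sampled pixel and one more per
element of `𝒯`; intensities cost no queries. This gives order `ε⁻² δ⁻⁶` up to logarithms, within the
claimed `ε⁻² δ⁻⁸`.

The covers come from a grid on the six parameters of an affine map and the two of an intensity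
transformation. When `δ > 1/(16c)` or `ε > 1`, the allowed error is at least 1 and no query is
needed. -/

/-! ### Pixels, gradients and the perimeter size. -/

theorem card_pixels (n : ℕ) : (pixels n).card = n ^ 2 := by
  simp [pixels, Finset.card_product, sq]

theorem mem_pixels {n : ℕ} {z : ℤ × ℤ} :
    z ∈ pixels n ↔ (1 ≤ z.1 ∧ z.1 ≤ n) ∧ 1 ≤ z.2 ∧ z.2 ≤ n := by
  simp [pixels, Finset.mem_product]

theorem card_pixel (n : ℕ) : Fintype.card (Pixel n) = n ^ 2 := by
  rw [Fintype.card_coe, card_pixels]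

theorem GrayImage.abs_sub_le_one {n : ℕ} (M : GrayImage n) (p q : Pixel n) :
    |(M p : ℝ) - (M q : ℝ)| ≤ 1 := by
  have hp := (M p).2
  have hq := (M q).2
  rw [Set.mem_Icc] at hp hq
  rw [abs_le]
  constructor <;> linarith

theorem GrayImage.le_gradient {n : ℕ} (M : GrayImage n) {p q : Pixel n} (h : p.Adjacent q) :
    |(M p : ℝ) - (M q : ℝ)| ≤ M.gradient p :=
  le_ciSup (f := fun q : {q : Pixel n // p.Adjacent q} => |(M p : ℝ) - (M q.1 : ℝ)|)
    (Set.finite_range _).bddAbove ⟨q, h⟩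

theorem GrayImage.gradient_nonneg {n : ℕ} (M : GrayImage n) (p : Pixel n) : 0 ≤ M.gradient p :=
  Real.iSup_nonneg fun _ => abs_nonneg _

open Classical in
/-- The contribution of a lattice point to the perimeter size; it is `0` outside of the image. -/
noncomputable def GrayImage.perimeterTerm {n : ℕ} (M : GrayImage n) (z : ℤ × ℤ) : ℝ :=
  if h : z ∈ pixels n then
    if Pixel.Outermost (⟨z, h⟩ : Pixel n) then 1 else M.gradient ⟨z, h⟩
  else 0

theorem GrayImage.perimeterTerm_nonneg {n : ℕ} (M : GrayImage n) (z : ℤ × ℤ) :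
    0 ≤ M.perimeterTerm z := by
  unfold GrayImage.perimeterTerm
  split_ifs
  · exact zero_le_one
  · exact M.gradient_nonneg _
  · exact le_rfl

theorem GrayImage.sum_perimeterTerm {n : ℕ} (M : GrayImage n) :
    ∑ z ∈ pixels n, M.perimeterTerm z = M.perimeter := by
  rw [GrayImage.perimeter, ← Finset.sum_coe_sort]
  refine Finset.sum_congr rfl fun p _ => ?_
  simp [GrayImage.perimeterTerm]

/-- One side of the square already consists of `n` outermost pixels. This lets an additive error `δ`
be absorbed into `δ / n` times the perimeter size. -/
theorem GrayImage.le_perimeter {n : ℕ} (M : GrayImage n) : (n : ℝ) ≤ M.perimeter := by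
  classical
  rcases Nat.eq_zero_or_pos n with rfl | hn
  · rw [← M.sum_perimeterTerm]
    simpa using Finset.sum_nonneg fun z _ => M.perimeterTerm_nonneg z
  have hsub : (Finset.Icc (1 : ℤ) n).image (fun j => ((1 : ℤ), j)) ⊆ pixels n := by
    intro z hz
    obtain ⟨j, hj, rfl⟩ := Finset.mem_image.1 hz
    rw [Finset.mem_Icc] at hj
    exact mem_pixels.2 ⟨⟨le_rfl, by show (1 : ℤ) ≤ n; omega⟩, hj⟩
  have hterm : ∀ z ∈ (Finset.Icc (1 : ℤ) n).image (fun j => ((1 : ℤ), j)),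
      M.perimeterTerm z = 1 := by
    intro z hz
    have hmem := hsub hz
    obtain ⟨j, hj, rfl⟩ := Finset.mem_image.1 hz
    simp [GrayImage.perimeterTerm, hmem, Pixel.Outermost]
  calc (n : ℝ) = ∑ z ∈ (Finset.Icc (1 : ℤ) n).image (fun j => ((1 : ℤ), j)), (1 : ℝ) := by
        rw [Finset.sum_const, Finset.card_image_of_injective]
        · simp
        · intro a b h
          simpa using h
    _ = ∑ z ∈ (Finset.Icc (1 : ℤ) n).image (fun j => ((1 : ℤ), j)), M.perimeterTerm z :=
        (Finset.sum_congr rfl hterm).symm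
    _ ≤ ∑ z ∈ pixels n, M.perimeterTerm z :=
        Finset.sum_le_sum_of_subset_of_nonneg hsub fun z _ _ => M.perimeterTerm_nonneg z
    _ = M.perimeter := M.sum_perimeterTerm

/-! ## Intensity transformations -/

theorem Intensity.apply_nonneg (L : Intensity) (v : ℝ) : 0 ≤ L.apply v := le_max_left _ _

theorem Intensity.apply_le_one (L : Intensity) (v : ℝ) : L.apply v ≤ 1 :=
  max_le zero_le_one (min_le_left _ _)

theorem abs_clamp_sub_clamp_le (a b : ℝ) :
    |max 0 (min 1 a) - max 0 (min 1 b)| ≤ |a - b| := by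
  rw [max_comm 0, max_comm 0, min_comm 1, min_comm 1]
  exact (abs_max_sub_max_le_abs _ _ _).trans (abs_inf_sub_inf_le_abs a b 1)

theorem Intensity.abs_apply_sub_apply_le {c : ℝ} (hc : 1 ≤ c) {L : Intensity}
    (hL : L ∈ intensityFamily c) (v w : ℝ) : |L.apply v - L.apply w| ≤ c * |v - w| := by
  have h0 : 0 ≤ L.con := le_trans (by positivity) hL.1.1
  refine (abs_clamp_sub_clamp_le _ _).trans ?_
  rw [show L.con * v + L.bri - (L.con * w + L.bri) = L.con * (v - w) by ring, abs_mul,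
    abs_of_nonneg h0]
  exact mul_le_mul_of_nonneg_right hL.1.2 (abs_nonneg _)

/-! ## The contribution of one pixel to the distance -/

/-- The contribution to the distance of a pixel with value `v` that is mapped to `z`. -/
noncomputable def mismatch {n : ℕ} (L : Intensity) (M : GrayImage n) (v : ℝ) (z : ℤ × ℤ) : ℝ :=
  if h : z ∈ pixels n then |v - L.apply (M ⟨z, h⟩)| else 1

theorem imageDistWith_eq {n : ℕ} (T : PlaneAffine) (L : Intensity) (M₁ M₂ : GrayImage n) :
    imageDistWith T L M₁ M₂ =
      (1 / (n : ℝ) ^ 2) * ∑ p : Pixel n, mismatch L M₂ (M₁ p) (imageAffine T p.1) := rfl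

theorem mismatch_nonneg {n : ℕ} (L : Intensity) (M : GrayImage n) (v : ℝ) (z : ℤ × ℤ) :
    0 ≤ mismatch L M v z := by
  unfold mismatch
  split_ifs
  · exact abs_nonneg _
  · exact zero_le_one

theorem mismatch_le_one {n : ℕ} (L : Intensity) (M : GrayImage n) {v : ℝ}
    (hv : v ∈ Set.Icc (0 : ℝ) 1) (z : ℤ × ℤ) : mismatch L M v z ≤ 1 := by
  unfold mismatch
  split_ifs with h
  · have h0 := L.apply_nonneg (M ⟨z, h⟩)
    have h1 := L.apply_le_one (M ⟨z, h⟩)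
    rw [abs_le]
    constructor <;> linarith [hv.1, hv.2]
  · exact le_rfl

theorem abs_mismatch_sub_le_one {n : ℕ} (L : Intensity) (M : GrayImage n) {v : ℝ}
    (hv : v ∈ Set.Icc (0 : ℝ) 1) (z w : ℤ × ℤ) :
    |mismatch L M v z - mismatch L M v w| ≤ 1 := by
  have := mismatch_nonneg L M v z
  have := mismatch_nonneg L M v w
  have := mismatch_le_one L M hv z
  have := mismatch_le_one L M hv w
  rw [abs_le]
  constructor <;> linarith

theorem perimeterTerm_of_neighbour_notMem {n : ℕ} (M : GrayImage n) {z w : ℤ × ℤ}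
    (h1 : |z.1 - w.1| ≤ 1) (h2 : |z.2 - w.2| ≤ 1) (hz : z ∈ pixels n) (hw : w ∉ pixels n) :
    M.perimeterTerm z = 1 := by
  have hout : Pixel.Outermost (⟨z, hz⟩ : Pixel n) := by
    rw [mem_pixels] at hz hw
    rw [abs_le] at h1 h2
    simp only [Pixel.Outermost]
    omega
  simp [GrayImage.perimeterTerm, hz, hout]

/-- Inside the image the gradient bounds the change of value and `L` is `c`-Lipschitz. If exactly
one point lies inside, that one is outermost, and its term 1 pays for the jump. If both lie outside,
nothing changes. -/
theorem abs_mismatch_sub_le_of_adjacent {n : ℕ} {c : ℝ} (hc : 1 ≤ c) {L : Intensity}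
    (hL : L ∈ intensityFamily c) (M : GrayImage n) {v : ℝ} (hv : v ∈ Set.Icc (0 : ℝ) 1)
    {z w : ℤ × ℤ} (h1 : |z.1 - w.1| ≤ 1) (h2 : |z.2 - w.2| ≤ 1) :
    |mismatch L M v z - mismatch L M v w| ≤ c * (M.perimeterTerm z + M.perimeterTerm w) := by
  have hz0 := M.perimeterTerm_nonneg z
  have hw0 := M.perimeterTerm_nonneg w
  by_cases hz : z ∈ pixels n <;> by_cases hw : w ∈ pixels n
  · have key : |(M ⟨z, hz⟩ : ℝ) - M ⟨w, hw⟩| ≤ M.perimeterTerm z := by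
      by_cases hzw : z = w
      · subst hzw
        simpa using hz0
      rw [GrayImage.perimeterTerm, dif_pos hz]
      split_ifs
      · exact M.abs_sub_le_one _ _
      · exact M.le_gradient ⟨fun h => hzw (congrArg Subtype.val h), h1, h2⟩
    have h3 := L.abs_apply_sub_apply_le hc hL (M ⟨z, hz⟩) (M ⟨w, hw⟩)
    have h4 : |mismatch L M v z - mismatch L M v w| ≤
        |L.apply (M ⟨z, hz⟩) - L.apply (M ⟨w, hw⟩)| := by
      rw [mismatch, mismatch, dif_pos hz, dif_pos hw]
      refine (abs_abs_sub_abs_le _ _).trans (le_of_eq ?_)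
      rw [abs_sub_comm (L.apply _)]
      congr 1
      ring
    refine (h4.trans h3).trans (mul_le_mul_of_nonneg_left ?_ (by linarith))
    linarith
  · have := perimeterTerm_of_neighbour_notMem M h1 h2 hz hw
    have := abs_mismatch_sub_le_one L M hv z w
    nlinarith
  · have := perimeterTerm_of_neighbour_notMem M (abs_sub_comm z.1 w.1 ▸ h1)
      (abs_sub_comm z.2 w.2 ▸ h2) hw hz
    have := abs_mismatch_sub_le_one L M hv z w
    nlinarith
  · rw [mismatch, mismatch, dif_neg hz, dif_neg hw]
    simp only [sub_self, abs_zero]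
    positivity

theorem abs_mismatch_sub_le_of_path {n : ℕ} {c : ℝ} (hc : 1 ≤ c) {L : Intensity}
    (hL : L ∈ intensityFamily c) (M : GrayImage n) {v : ℝ} (hv : v ∈ Set.Icc (0 : ℝ) 1)
    (z : ℕ → ℤ × ℤ) (N : ℕ)
    (hz : ∀ i, |(z i).1 - (z (i + 1)).1| ≤ 1 ∧ |(z i).2 - (z (i + 1)).2| ≤ 1) :
    |mismatch L M v (z 0) - mismatch L M v (z N)| ≤
      2 * c * ∑ i ∈ Finset.range (N + 1), M.perimeterTerm (z i) := by
  -- Interior points of the path are charged by two steps, the last one so far only by one.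
  -- Subtracting its term leaves room for the next step.
  have hstrong : |mismatch L M v (z 0) - mismatch L M v (z N)| ≤
      c * (2 * ∑ i ∈ Finset.range (N + 1), M.perimeterTerm (z i) - M.perimeterTerm (z N)) := by
    induction N with
    | zero =>
      have := M.perimeterTerm_nonneg (z 0)
      simp only [sub_self, abs_zero, zero_add, Finset.range_one, Finset.sum_singleton]
      nlinarith
    | succ N ih =>
      have h1 := abs_mismatch_sub_le_of_adjacent hc hL M hv (hz N).1 (hz N).2
      have h2 := abs_sub_le (mismatch L M v (z 0)) (mismatch L M v (z N))
        (mismatch L M v (z (N + 1)))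
      rw [Finset.sum_range_succ]
      linarith
  have := mul_nonneg (by linarith : 0 ≤ c) (M.perimeterTerm_nonneg (z N))
  linarith

/-! ## Affine maps -/

theorem Plane.abs_apply_le_norm (v : Plane) (i : Fin 2) : |v i| ≤ ‖v‖ :=
  PiLp.norm_apply_le v i

theorem Plane.norm_le (v : Plane) : ‖v‖ ≤ |v 0| + |v 1| := by
  rw [EuclideanSpace.norm_eq, Fin.sum_univ_two, Real.norm_eq_abs, Real.norm_eq_abs]
  refine Real.sqrt_le_iff.2 ⟨by positivity, ?_⟩
  nlinarith [abs_nonneg (v 0), abs_nonneg (v 1)]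

theorem Plane.eq_smul_single_add (v : Plane) :
    v = v 0 • EuclideanSpace.single (0 : Fin 2) (1 : ℝ) +
      v 1 • EuclideanSpace.single (1 : Fin 2) (1 : ℝ) := by
  ext i
  fin_cases i <;> simp

/-- An affine map of norm at most `α` on the square has a linear part of norm `O(α / n)`. -/
theorem norm_linear_le_of_norm_le {n : ℕ} (hn : 0 < n) {α : ℝ} {D : PlaneAffine}
    (hD : ∀ x : Plane, (∀ i, x i ∈ Set.Ico (1 : ℝ) (n + 1)) → ‖D x‖ ≤ α) (v : Plane) :
    ‖D.linear v‖ ≤ 8 * (α / n) * ‖v‖ := by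
  have hn' : (0 : ℝ) < n := by exact_mod_cast hn
  have hbase : ∀ i : Fin 2, ‖D.linear (EuclideanSpace.single i (1 : ℝ))‖ ≤ 4 * (α / n) := by
    intro i
    have h0 : ‖D !₂[1, 1]‖ ≤ α := hD _ fun j => by
      fin_cases j <;> simp [hn]
    -- A shift of `n / 2` from the corner stays inside the half-open square; comparing the two
    -- values bounds `D.linear` on a basis vector by `4 α / n`.
    have h1 : ‖D (!₂[1, 1] + ((n : ℝ) / 2) • EuclideanSpace.single i (1 : ℝ))‖ ≤ α :=
      hD _ fun j => by
        fin_cases i <;> fin_cases j <;> simp [hn] <;> (try constructor) <;> linarith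
    have h2 : ((n : ℝ) / 2) • D.linear (EuclideanSpace.single i (1 : ℝ)) =
        D (!₂[1, 1] + ((n : ℝ) / 2) • EuclideanSpace.single i (1 : ℝ)) - D !₂[1, 1] := by
      have := D.linearMap_vsub (!₂[1, 1] + ((n : ℝ) / 2) • EuclideanSpace.single i (1 : ℝ)) !₂[1, 1]
      simp only [vsub_eq_sub, add_sub_cancel_left, map_smul] at this
      exact this
    have h3 : (n : ℝ) / 2 * ‖D.linear (EuclideanSpace.single i (1 : ℝ))‖ ≤ α + α := by
      rw [← abs_of_nonneg (by positivity : (0 : ℝ) ≤ (n : ℝ) / 2), ← Real.norm_eq_abs,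
        ← norm_smul, h2]
      exact (norm_sub_le _ _).trans (add_le_add h1 h0)
    rw [mul_div_assoc', le_div_iff₀ hn']
    linarith
  have hα : 0 ≤ 4 * (α / n) := (norm_nonneg _).trans (hbase 0)
  have h0 := Plane.abs_apply_le_norm v 0
  have h1 := Plane.abs_apply_le_norm v 1
  calc ‖D.linear v‖ ≤ |v 0| * ‖D.linear (EuclideanSpace.single 0 (1 : ℝ))‖ +
        |v 1| * ‖D.linear (EuclideanSpace.single 1 (1 : ℝ))‖ := by
        conv_lhs => rw [Plane.eq_smul_single_add v, map_add, map_smul, map_smul]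
        refine (norm_add_le _ _).trans (le_of_eq ?_)
        rw [norm_smul, norm_smul, Real.norm_eq_abs, Real.norm_eq_abs]
    _ ≤ ‖v‖ * (4 * (α / n)) + ‖v‖ * (4 * (α / n)) := by
        gcongr
        · exact hbase 0
        · exact hbase 1
    _ = 8 * (α / n) * ‖v‖ := by ring

theorem pixelPoint_mem {n : ℕ} {p : ℤ × ℤ} (hp : p ∈ pixels n) (i : Fin 2) :
    pixelPoint p i ∈ Set.Ico (1 : ℝ) (n + 1) := by
  obtain ⟨⟨h1, h2⟩, h3, h4⟩ := mem_pixels.1 hp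
  have h1' : (1 : ℝ) ≤ p.1 := by exact_mod_cast h1
  have h2' : (p.1 : ℝ) ≤ n := by exact_mod_cast h2
  have h3' : (1 : ℝ) ≤ p.2 := by exact_mod_cast h3
  have h4' : (p.2 : ℝ) ≤ n := by exact_mod_cast h4
  fin_cases i <;> simp [pixelPoint] <;> constructor <;> linarith

/-- Two pixels in one fibre have images at distance at most 2, hence are themselves at distance at
most `4 c`, so the fibre lies in a box around any of its points. The factor `2 * c` instead of `c`
leaves room for interpolated maps. -/
theorem card_fibre_imageAffine_le {n : ℕ} {c : ℝ} {T : PlaneAffine}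
    (hT : ∀ v : Plane, ‖v‖ ≤ 2 * c * ‖T.linear v‖) (hc : 0 ≤ c) (z : ℤ × ℤ) :
    ((pixels n).filter fun p => imageAffine T p = z).card ≤ (2 * ⌈4 * c⌉₊ + 1) ^ 2 := by
  rcases ((pixels n).filter fun p => imageAffine T p = z).eq_empty_or_nonempty with h | ⟨q, hq⟩
  · simp [h]
  set m := ⌈4 * c⌉₊
  have hsub : ((pixels n).filter fun p => imageAffine T p = z) ⊆
      Finset.Icc (q.1 - m) (q.1 + m) ×ˢ Finset.Icc (q.2 - m) (q.2 + m) := by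
    intro p hp
    have hpq : imageAffine T p = imageAffine T q :=
      (Finset.mem_filter.1 hp).2.trans (Finset.mem_filter.1 hq).2.symm
    have e0 := Int.abs_sub_lt_one_of_floor_eq_floor (congrArg Prod.fst hpq)
    have e1 := Int.abs_sub_lt_one_of_floor_eq_floor (congrArg Prod.snd hpq)
    have h1 : ‖T.linear (pixelPoint p - pixelPoint q)‖ ≤ 2 := by
      have h2 := T.linearMap_vsub (pixelPoint p) (pixelPoint q)
      rw [vsub_eq_sub, vsub_eq_sub] at h2
      rw [h2]
      refine (Plane.norm_le _).trans ?_
      rw [PiLp.sub_apply, PiLp.sub_apply]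
      linarith
    have h2 : ‖pixelPoint p - pixelPoint q‖ ≤ m :=
      ((hT _).trans (by nlinarith)).trans (Nat.le_ceil (4 * c))
    have h3 := (Plane.abs_apply_le_norm _ 0).trans h2
    have h4 := (Plane.abs_apply_le_norm _ 1).trans h2
    simp only [pixelPoint, PiLp.sub_apply, Matrix.cons_val_zero, Matrix.cons_val_one] at h3 h4
    have h3' : |p.1 - q.1| ≤ (m : ℤ) := by exact_mod_cast h3
    have h4' : |p.2 - q.2| ≤ (m : ℤ) := by exact_mod_cast h4
    rw [abs_le] at h3' h4'
    simp only [Finset.mem_product, Finset.mem_Icc]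
    omega
  refine (Finset.card_le_card hsub).trans (le_of_eq ?_)
  rw [Finset.card_product, Int.card_Icc, Int.card_Icc, sq]
  congr 1 <;> omega

theorem sum_perimeterTerm_imageAffine_le {n : ℕ} {c : ℝ} {T : PlaneAffine}
    (hT : ∀ v : Plane, ‖v‖ ≤ 2 * c * ‖T.linear v‖) (hc : 0 ≤ c) (M : GrayImage n) :
    ∑ p : Pixel n, M.perimeterTerm (imageAffine T p.1) ≤
      (2 * ⌈4 * c⌉₊ + 1 : ℝ) ^ 2 * M.perimeter := by
  classical
  rw [Finset.sum_coe_sort (pixels n) fun p => M.perimeterTerm (imageAffine T p)]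
  calc ∑ p ∈ pixels n, M.perimeterTerm (imageAffine T p)
      = ∑ p ∈ (pixels n).filter (fun p => imageAffine T p ∈ pixels n),
          M.perimeterTerm (imageAffine T p) := by
        refine (Finset.sum_filter_of_ne fun p _ hp => ?_).symm
        by_contra h
        exact hp (by simp [GrayImage.perimeterTerm, h])
    _ = ∑ z ∈ pixels n, ∑ p ∈ (pixels n).filter (fun p => imageAffine T p ∈ pixels n) with
          imageAffine T p = z, M.perimeterTerm (imageAffine T p) :=
        (Finset.sum_fiberwise_of_maps_to (fun p hp => (Finset.mem_filter.1 hp).2) _).symm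
    _ ≤ ∑ z ∈ pixels n, (2 * ⌈4 * c⌉₊ + 1 : ℝ) ^ 2 * M.perimeterTerm z := by
        refine Finset.sum_le_sum fun z _ => ?_
        rw [Finset.sum_congr rfl fun p hp => by rw [(Finset.mem_filter.1 hp).2],
          Finset.sum_const, nsmul_eq_mul]
        refine mul_le_mul_of_nonneg_right ?_ (M.perimeterTerm_nonneg z)
        have h1 : (((pixels n).filter (fun p => imageAffine T p ∈ pixels n)).filter
            fun p => imageAffine T p = z).card ≤ (2 * ⌈4 * c⌉₊ + 1) ^ 2 :=
          (Finset.card_le_card (Finset.filter_subset_filter _ (Finset.filter_subset _ _))).trans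
            (card_fibre_imageAffine_le hT hc z)
        exact_mod_cast h1
    _ = _ := by rw [← Finset.mul_sum, M.sum_perimeterTerm]

theorem abs_floor_sub_floor_le_one {a b : ℝ} (h : |a - b| ≤ 1) : |⌊a⌋ - ⌊b⌋| ≤ 1 := by
  rw [abs_le] at h ⊢
  have h1 := Int.floor_le a
  have h2 := Int.lt_floor_add_one a
  have h3 := Int.floor_le b
  have h4 := Int.lt_floor_add_one b
  have h5 : ((⌊a⌋ - ⌊b⌋ : ℤ) : ℝ) < (2 : ℤ) := by push_cast; linarith
  have h6 : ((-2 : ℤ) : ℝ) < ((⌊a⌋ - ⌊b⌋ : ℤ) : ℝ) := by push_cast; linarith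
  have h7 := Int.cast_lt.1 h5
  have h8 := Int.cast_lt.1 h6
  omega

/-! ## Continuity of the distance in the transformation -/

/-- Close affine maps have distances that differ by `O(δ / n)` times the perimeter size. -/
theorem abs_imageDistWith_sub_le_of_affineClose {n : ℕ} {c δ : ℝ} (hc : 1 ≤ c)
    (hδ : δ ≤ 1 / (16 * c)) (hδn : 1 ≤ δ * n) {T T' : PlaneAffine} (hT : T ∈ affineFamily c)
    (hTT' : AffineClose n (δ * n) T T') {L : Intensity} (hL : L ∈ intensityFamily c)
    (M₁ M₂ : GrayImage n) :
    |imageDistWith T L M₁ M₂ - imageDistWith T' L M₁ M₂| ≤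
      6 * c * (2 * ⌈4 * c⌉₊ + 1 : ℝ) ^ 2 * (δ / n * M₂.perimeter) := by
  have hn : 0 < n := by
    rcases Nat.eq_zero_or_pos n with rfl | h
    · norm_num at hδn
    · exact h
  have hn' : (0 : ℝ) < n := by exact_mod_cast hn
  have hc0 : 0 < c := by linarith
  set N := ⌈δ * n⌉₊
  have hN : δ * n ≤ N := Nat.le_ceil _
  have hN2 : (N : ℝ) + 1 ≤ 3 * (δ * n) := by
    -- Here `1 ≤ δ * n` makes the two units lost to rounding and to counting both endpoints
    -- harmless.
    have := Nat.ceil_lt_add_one (show 0 ≤ δ * n by linarith)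
    linarith
  have hN0 : (0 : ℝ) < N := by linarith
  set D : PlaneAffine := T' - T with hDdef
  have hDapp : ∀ x, D x = T' x - T x := fun x => rfl
  have hD : ∀ x : Plane, (∀ i, x i ∈ Set.Ico (1 : ℝ) (n + 1)) → ‖D x‖ ≤ δ * n := by
    intro x hx
    rw [hDapp, ← dist_eq_norm, dist_comm]
    exact hTT' x hx
  let path : ℕ → PlaneAffine := fun i => T + ((i : ℝ) / N) • D
  have hpath : ∀ i x, path i x = T x + ((i : ℝ) / N) • D x := fun i x => rfl
  -- An interpolated map need not belong to the family, but its linear part differs from that of `T`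
  -- by at most `8 δ ≤ 1 / (2 c)` in norm, so half of the lower bound `1 / c` survives.
  have hlin : ∀ i ≤ N, ∀ v : Plane, ‖v‖ ≤ 2 * c * ‖(path i).linear v‖ := by
    intro i hi v
    have h1 : (path i).linear v = T.linear v + ((i : ℝ) / N) • D.linear v := rfl
    have h2 : ‖((i : ℝ) / N) • D.linear v‖ ≤ 1 / (2 * c) * ‖v‖ := by
      rw [norm_smul, Real.norm_eq_abs, abs_of_nonneg (by positivity)]
      have h3 : (i : ℝ) / N ≤ 1 := div_le_one_of_le₀ (by exact_mod_cast hi) hN0.le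
      have h4 := norm_linear_le_of_norm_le hn hD v
      rw [mul_div_assoc, div_self hn'.ne', mul_one] at h4
      have h5 : 8 * δ ≤ 1 / (2 * c) := by
        have : 1 / (2 * c) = 8 * (1 / (16 * c)) := by field_simp; norm_num
        linarith
      calc (i : ℝ) / N * ‖D.linear v‖ ≤ 1 * ‖D.linear v‖ := by gcongr
        _ ≤ 8 * δ * ‖v‖ := by linarith
        _ ≤ _ := by gcongr
    have h3 := (hT v).1
    have h4 : ‖T.linear v‖ - ‖((i : ℝ) / N) • D.linear v‖ ≤ ‖(path i).linear v‖ := by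
      rw [h1]
      exact norm_sub_le_norm_add _ _
    have h5 : ‖v‖ / c = 2 * (1 / (2 * c) * ‖v‖) := by field_simp
    calc ‖v‖ = 2 * c * (1 / (2 * c) * ‖v‖) := by field_simp
      _ ≤ 2 * c * ‖(path i).linear v‖ := by
        refine mul_le_mul_of_nonneg_left ?_ (by positivity)
        linarith
  have hstep : ∀ (p : Pixel n) (i : ℕ) (j : Fin 2),
      |⌊path i (pixelPoint p.1) j⌋ - ⌊path (i + 1) (pixelPoint p.1) j⌋| ≤ 1 := by
    intro p i j
    refine abs_floor_sub_floor_le_one ?_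
    have h1 : path i (pixelPoint p.1) j - path (i + 1) (pixelPoint p.1) j =
        -(D (pixelPoint p.1) j / N) := by
      rw [hpath, hpath, PiLp.add_apply, PiLp.add_apply, PiLp.smul_apply, PiLp.smul_apply,
        smul_eq_mul, smul_eq_mul]
      push_cast
      ring
    rw [h1, abs_neg, abs_div, abs_of_pos hN0, div_le_one hN0]
    exact ((Plane.abs_apply_le_norm _ j).trans (hD _ (pixelPoint_mem p.2))).trans hN
  have hpix : ∀ p : Pixel n,
      |mismatch L M₂ (M₁ p) (imageAffine T p.1) - mismatch L M₂ (M₁ p) (imageAffine T' p.1)| ≤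
      2 * c * ∑ i ∈ Finset.range (N + 1), M₂.perimeterTerm (imageAffine (path i) p.1) := by
    intro p
    have h := abs_mismatch_sub_le_of_path hc hL M₂ (M₁ p).2
      (fun i => imageAffine (path i) p.1) N fun i => ⟨hstep p i 0, hstep p i 1⟩
    have h0 : path 0 = T := by
      simp [path]
    have h1 : path N = T' := by
      simp [path, div_self hN0.ne', D]
    simpa only [h0, h1] using h
  have hP : 0 ≤ M₂.perimeter := hn'.le.trans M₂.le_perimeter
  rw [imageDistWith_eq, imageDistWith_eq, ← mul_sub, ← Finset.sum_sub_distrib, abs_mul,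
    abs_of_nonneg (by positivity)]
  calc _ ≤ 1 / (n : ℝ) ^ 2 * ∑ p : Pixel n, 2 * c * ∑ i ∈ Finset.range (N + 1),
        M₂.perimeterTerm (imageAffine (path i) p.1) := by
        refine mul_le_mul_of_nonneg_left ?_ (by positivity)
        exact (Finset.abs_sum_le_sum_abs _ _).trans (Finset.sum_le_sum fun p _ => hpix p)
    _ = 1 / (n : ℝ) ^ 2 * (2 * c * ∑ i ∈ Finset.range (N + 1), ∑ p : Pixel n,
        M₂.perimeterTerm (imageAffine (path i) p.1)) := by
        rw [← Finset.mul_sum, Finset.sum_comm]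
    _ ≤ 1 / (n : ℝ) ^ 2 * (2 * c * ∑ i ∈ Finset.range (N + 1),
        (2 * ⌈4 * c⌉₊ + 1 : ℝ) ^ 2 * M₂.perimeter) := by
        gcongr with i hi
        exact sum_perimeterTerm_imageAffine_le
          (hlin i (Nat.lt_succ_iff.1 (Finset.mem_range.1 hi))) hc0.le M₂
    _ = 1 / (n : ℝ) ^ 2 * (2 * c * ((N + 1) * ((2 * ⌈4 * c⌉₊ + 1 : ℝ) ^ 2 * M₂.perimeter))) := by
        simp
    _ ≤ 1 / (n : ℝ) ^ 2 *
        (2 * c * (3 * (δ * n) * ((2 * ⌈4 * c⌉₊ + 1 : ℝ) ^ 2 * M₂.perimeter))) := by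
        gcongr
    _ = _ := by
        field_simp
        ring

theorem abs_imageDistWith_sub_le_of_intensity_close {n : ℕ} (hn : 0 < n) {δ : ℝ} (T : PlaneAffine)
    {L L' : Intensity} (hL : ∀ v ∈ Set.Icc (0 : ℝ) 1, |L.apply v - L'.apply v| ≤ δ)
    (M₁ M₂ : GrayImage n) :
    |imageDistWith T L M₁ M₂ - imageDistWith T L' M₁ M₂| ≤ δ := by
  have hn' : (0 : ℝ) < n := by exact_mod_cast hn
  have hδ : 0 ≤ δ := (abs_nonneg _).trans (hL 0 (by simp))
  have hpix : ∀ p : Pixel n, |mismatch L M₂ (M₁ p) (imageAffine T p.1) -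
      mismatch L' M₂ (M₁ p) (imageAffine T p.1)| ≤ δ := by
    intro p
    unfold mismatch
    split_ifs with h
    · refine (abs_abs_sub_abs_le _ _).trans ?_
      rw [sub_sub_sub_cancel_left, abs_sub_comm]
      exact hL _ (M₂ ⟨_, h⟩).2
    · simpa using hδ
  rw [imageDistWith_eq, imageDistWith_eq, ← mul_sub, ← Finset.sum_sub_distrib, abs_mul,
    abs_of_nonneg (by positivity)]
  calc _ ≤ 1 / (n : ℝ) ^ 2 * ∑ _p : Pixel n, δ := by
        refine mul_le_mul_of_nonneg_left ?_ (by positivity)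
        exact (Finset.abs_sum_le_sum_abs _ _).trans (Finset.sum_le_sum fun p _ => hpix p)
    _ = δ := by
        rw [Finset.sum_const, Finset.card_univ, card_pixel, nsmul_eq_mul]
        push_cast
        field_simp

/-! ### Bounds on the distance and near-optimality of covers. -/

theorem imageDistWith_nonneg {n : ℕ} (T : PlaneAffine) (L : Intensity) (M₁ M₂ : GrayImage n) :
    0 ≤ imageDistWith T L M₁ M₂ := by
  rw [imageDistWith_eq]
  exact mul_nonneg (by positivity) (Finset.sum_nonneg fun p _ => mismatch_nonneg _ _ _ _)

theorem imageDistWith_le_one {n : ℕ} (T : PlaneAffine) (L : Intensity) (M₁ M₂ : GrayImage n) :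
    imageDistWith T L M₁ M₂ ≤ 1 := by
  rw [imageDistWith_eq]
  calc _ ≤ 1 / (n : ℝ) ^ 2 * ∑ _p : Pixel n, (1 : ℝ) := by
        gcongr with p
        exact mismatch_le_one _ _ (M₁ p).2 _
    _ ≤ 1 := by
        rw [Finset.sum_const, Finset.card_univ, card_pixel, nsmul_eq_mul]
        push_cast
        rw [mul_one, one_div_mul_eq_div]
        exact div_self_le_one _

theorem imageDistWith_eq_one {n : ℕ} (hn : 0 < n) {T : PlaneAffine} (hT : ¬ HitsImage n T)
    (L : Intensity) (M₁ M₂ : GrayImage n) : imageDistWith T L M₁ M₂ = 1 := by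
  have hn' : (0 : ℝ) < n := by exact_mod_cast hn
  have h : ∀ p : Pixel n, mismatch L M₂ (M₁ p) (imageAffine T p.1) = 1 := fun p =>
    dif_neg fun h => hT ⟨p.1, p.2, h⟩
  rw [imageDistWith_eq, Finset.sum_congr rfl fun p _ => h p, Finset.sum_const, Finset.card_univ,
    card_pixel, nsmul_eq_mul]
  push_cast
  field_simp

theorem imageDist_le {n : ℕ} {c : ℝ} {T : PlaneAffine} (hT : T ∈ affineFamily c) {L : Intensity}
    (hL : L ∈ intensityFamily c) (M₁ M₂ : GrayImage n) :
    imageDist c M₁ M₂ ≤ imageDistWith T L M₁ M₂ := by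
  refine csInf_le ⟨0, ?_⟩ ⟨T, hT, L, hL, rfl⟩
  rintro _ ⟨T', _, L', _, rfl⟩
  exact imageDistWith_nonneg _ _ _ _

theorem id_mem_affineFamily {c : ℝ} (hc : 1 ≤ c) : AffineMap.id ℝ Plane ∈ affineFamily c := by
  intro v
  rw [AffineMap.id_linear, LinearMap.id_apply]
  exact ⟨div_le_self (norm_nonneg v) hc, le_mul_of_one_le_left (norm_nonneg v) hc⟩

theorem hitsImage_id {n : ℕ} (hn : 0 < n) : HitsImage n (AffineMap.id ℝ Plane) := by
  have h : ((1, 1) : ℤ × ℤ) ∈ pixels n :=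
    mem_pixels.2 ⟨⟨le_rfl, by show (1 : ℤ) ≤ n; omega⟩, le_rfl, by show (1 : ℤ) ≤ n; omega⟩
  refine ⟨(1, 1), h, ?_⟩
  simpa [imageAffine, pixelPoint] using h

theorem one_zero_mem_intensityFamily {c : ℝ} (hc : 1 ≤ c) :
    (⟨1, 0⟩ : Intensity) ∈ intensityFamily c :=
  ⟨⟨div_le_one_of_le₀ hc (by linarith), hc⟩, show -c ≤ 0 by linarith, zero_le_one⟩

theorem le_imageDist {n : ℕ} {c : ℝ} (hc : 1 ≤ c) {M₁ M₂ : GrayImage n} {d : ℝ}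
    (h : ∀ T ∈ affineFamily c, ∀ L ∈ intensityFamily c, d ≤ imageDistWith T L M₁ M₂) :
    d ≤ imageDist c M₁ M₂ := by
  refine le_csInf ⟨_, _, id_mem_affineFamily hc, _, one_zero_mem_intensityFamily hc, rfl⟩ ?_
  rintro _ ⟨T, hT, L, hL, rfl⟩
  exact h T hT L hL

theorem IsAffineCover.nonempty {c α : ℝ} (hc : 1 ≤ c) {n : ℕ} (hn : 0 < n)
    {𝒯 : Finset PlaneAffine} (h : IsAffineCover c n α 𝒯) : 𝒯.Nonempty := by
  obtain ⟨T, hT, -⟩ := h.2 _ (id_mem_affineFamily hc) (hitsImage_id hn)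
  exact ⟨T, hT⟩

theorem IsIntensityCover.nonempty {c α : ℝ} (hc : 1 ≤ c) {ℬ : Finset Intensity}
    (h : IsIntensityCover c α ℬ) : ℬ.Nonempty := by
  obtain ⟨L, hL, -⟩ := h.2 _ (one_zero_mem_intensityFamily hc)
  exact ⟨L, hL⟩

theorem abs_imageDistWith_sub_imageDist_le_one {n : ℕ} {c : ℝ} (hc : 1 ≤ c) {T : PlaneAffine}
    (hT : T ∈ affineFamily c) {L : Intensity} (hL : L ∈ intensityFamily c)
    (M₁ M₂ : GrayImage n) : |imageDistWith T L M₁ M₂ - imageDist c M₁ M₂| ≤ 1 := by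
  have h0 : 0 ≤ imageDist c M₁ M₂ := le_imageDist hc fun T _ L _ => imageDistWith_nonneg _ _ _ _
  have h1 := imageDist_le hT hL M₁ M₂
  have h2 := imageDistWith_le_one T L M₁ M₂
  rw [abs_le]
  constructor <;> linarith

/-- The best pair in the covers is almost optimal. -/
theorem exists_mem_covers_imageDistWith_le {n : ℕ} {c δ : ℝ} (hc : 1 ≤ c)
    (hδ : δ ≤ 1 / (16 * c)) (hδ0 : 0 < δ) (hδn : 1 ≤ δ * n) {𝒯 : Finset PlaneAffine}
    {ℬ : Finset Intensity} (h𝒯 : IsAffineCover c n (δ * n) 𝒯) (hℬ : IsIntensityCover c δ ℬ)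
    (M₁ M₂ : GrayImage n) {T : PlaneAffine} (hT : T ∈ affineFamily c) {L : Intensity}
    (hL : L ∈ intensityFamily c) :
    ∃ T' ∈ 𝒯, ∃ L' ∈ ℬ, imageDistWith T' L' M₁ M₂ ≤ imageDistWith T L M₁ M₂ +
      (6 * c * (2 * ⌈4 * c⌉₊ + 1 : ℝ) ^ 2 + 1) * (δ / n * M₂.perimeter) := by
  have hn : 0 < n := by
    rcases Nat.eq_zero_or_pos n with rfl | h
    · norm_num at hδn
    · exact h
  have hn' : (0 : ℝ) < n := by exact_mod_cast hn
  have hP : δ ≤ δ / n * M₂.perimeter := by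
    calc δ = δ / n * n := by field_simp
      _ ≤ _ := mul_le_mul_of_nonneg_left M₂.le_perimeter (by positivity)
  by_cases hhit : HitsImage n T
  · obtain ⟨T', hT', hTT'⟩ := h𝒯.2 T hT hhit
    obtain ⟨L', hL', hLL'⟩ := hℬ.2 L hL
    refine ⟨T', hT', L', hL', ?_⟩
    have h1 := abs_le.1 (abs_imageDistWith_sub_le_of_affineClose hc hδ hδn hT hTT' hL M₁ M₂)
    have h2 := abs_le.1 (abs_imageDistWith_sub_le_of_intensity_close hn T' hLL' M₁ M₂)
    linarith [h1.1, h2.1]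
  -- A map that misses the image has the largest possible distance 1, so any pair from the covers
  -- does at least as well.
  · obtain ⟨T', hT'⟩ := h𝒯.nonempty hc hn
    obtain ⟨L', hL'⟩ := hℬ.nonempty hc
    refine ⟨T', hT', L', hL', ?_⟩
    rw [imageDistWith_eq_one hn hhit]
    have h1 := imageDistWith_le_one T' L' M₁ M₂
    have h2 : 0 ≤ (6 * c * (2 * ⌈4 * c⌉₊ + 1 : ℝ) ^ 2 + 1) * (δ / n * M₂.perimeter) :=
      mul_nonneg (by positivity) (hδ0.le.trans hP)
    linarith

/-! ## Sampling -/

theorem exp_le_one_add_add_sq {y : ℝ} (hy : |y| ≤ 1) : Real.exp y ≤ 1 + y + y ^ 2 := by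
  have := (abs_le.1 (Real.abs_exp_sub_one_sub_id_le hy)).2
  linarith

section Sampling

variable {X : Type*} [Fintype X]

theorem sum_exp_le_of_sum_eq_zero (g : X → ℝ) (hg : ∀ x, |g x| ≤ 1) (h0 : ∑ x, g x = 0) {t : ℝ}
    (ht0 : 0 ≤ t) (ht : t ≤ 1) :
    ∑ x, Real.exp (t * g x) ≤ Fintype.card X * Real.exp (t ^ 2) := by
  have hterm : ∀ x, Real.exp (t * g x) ≤ 1 + t * g x + t ^ 2 := by
    intro x
    have h1 : |t * g x| ≤ 1 := by
      rw [abs_mul, abs_of_nonneg ht0]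
      exact mul_le_one₀ ht (abs_nonneg _) (hg x)
    have h2 : (t * g x) ^ 2 ≤ t ^ 2 := by
      rw [mul_pow, ← sq_abs (g x)]
      exact mul_le_of_le_one_right (sq_nonneg t) (pow_le_one₀ (abs_nonneg _) (hg x))
    exact (exp_le_one_add_add_sq h1).trans (by linarith)
  calc ∑ x, Real.exp (t * g x) ≤ ∑ x, (1 + t * g x + t ^ 2) :=
        Finset.sum_le_sum fun x _ => hterm x
    _ = Fintype.card X * (t ^ 2 + 1) := by
        rw [Finset.sum_add_distrib, Finset.sum_add_distrib, ← Finset.mul_sum, h0]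
        simp
        ring
    _ ≤ Fintype.card X * Real.exp (t ^ 2) :=
        mul_le_mul_of_nonneg_left (Real.add_one_le_exp _) (Nat.cast_nonneg _)

open Classical in
-- Chernoff's bound in counting form: the exponential moment over tuples factors as an `m`-th power,
-- and the parameter `ε / 2` yields the exponent `m ε² / 4 - m ε² / 2`.
theorem card_sum_large_le (g : X → ℝ) (hg : ∀ x, |g x| ≤ 1) (h0 : ∑ x, g x = 0) {ε : ℝ}
    (hε0 : 0 ≤ ε) (hε : ε ≤ 1) (m : ℕ) :
    ((Finset.univ.filter fun x : Fin m → X => m * ε ≤ ∑ i, g (x i)).card : ℝ) ≤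
      (Fintype.card X : ℝ) ^ m * Real.exp (-(m * ε ^ 2 / 4)) := by
  set S := Finset.univ.filter fun x : Fin m → X => m * ε ≤ ∑ i, g (x i)
  have h1 : (S.card : ℝ) * Real.exp (ε / 2 * (m * ε)) ≤
      (Fintype.card X : ℝ) ^ m * Real.exp (m * (ε / 2) ^ 2) := by
    calc (S.card : ℝ) * Real.exp (ε / 2 * (m * ε))
        = ∑ x ∈ S, Real.exp (ε / 2 * (m * ε)) := by simp
      _ ≤ ∑ x ∈ S, Real.exp (ε / 2 * ∑ i, g (x i)) := by
          refine Finset.sum_le_sum fun x hx => ?_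
          have := (Finset.mem_filter.1 hx).2
          gcongr
      _ ≤ ∑ x : Fin m → X, Real.exp (ε / 2 * ∑ i, g (x i)) :=
          Finset.sum_le_univ_sum_of_nonneg fun _ => (Real.exp_pos _).le
      _ = (∑ y, Real.exp (ε / 2 * g y)) ^ m := by
          rw [Fintype.sum_pow]
          refine Finset.sum_congr rfl fun x _ => ?_
          rw [Finset.mul_sum, Real.exp_sum]
      _ ≤ (Fintype.card X * Real.exp ((ε / 2) ^ 2)) ^ m :=
          pow_le_pow_left₀ (Finset.sum_nonneg fun _ _ => (Real.exp_pos _).le)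
            (sum_exp_le_of_sum_eq_zero g hg h0 (by linarith) (by linarith)) m
      _ = (Fintype.card X : ℝ) ^ m * Real.exp (m * (ε / 2) ^ 2) := by
          rw [mul_pow, Real.exp_nat_mul]
  rw [← le_div_iff₀ (Real.exp_pos _), mul_div_assoc, ← Real.exp_sub] at h1
  refine h1.trans (le_of_eq ?_)
  congr 2
  ring

open Classical in
theorem card_sample_mean_far_le [Nonempty X] (f : X → ℝ) (hf : ∀ x, f x ∈ Set.Icc (0 : ℝ) 1)
    {μ : ℝ} (hμ : ∑ x, f x = Fintype.card X * μ) {ε : ℝ} (hε0 : 0 ≤ ε) (hε : ε ≤ 1) (m : ℕ) :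
    ((Finset.univ.filter fun x : Fin m → X => m * ε ≤ |∑ i, f (x i) - m * μ|).card : ℝ) ≤
      (Fintype.card X : ℝ) ^ m * (2 * Real.exp (-(m * ε ^ 2 / 4))) := by
  have hcard : (0 : ℝ) < Fintype.card X := by exact_mod_cast Fintype.card_pos
  have hμ0 : 0 ≤ μ := by
    have : 0 ≤ ∑ x, f x := Finset.sum_nonneg fun x _ => (hf x).1
    rw [hμ] at this
    exact nonneg_of_mul_nonneg_right this hcard
  have hμ1 : μ ≤ 1 := by
    have : ∑ x, f x ≤ ∑ _x : X, (1 : ℝ) := Finset.sum_le_sum fun x _ => (hf x).2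
    rw [hμ] at this
    simp only [Finset.sum_const, Finset.card_univ, nsmul_eq_mul] at this
    exact le_of_mul_le_mul_left this hcard
  have hsum : ∑ x, (f x - μ) = 0 := by
    rw [Finset.sum_sub_distrib, hμ]
    simp
  have habs : ∀ x, |f x - μ| ≤ 1 := fun x => by
    rw [abs_le]
    constructor <;> linarith [(hf x).1, (hf x).2]
  have h1 := card_sum_large_le (fun x => f x - μ) habs hsum hε0 hε m
  have h2 := card_sum_large_le (fun x => -(f x - μ)) (fun x => by rw [abs_neg]; exact habs x)
    (by rw [Finset.sum_neg_distrib, hsum, neg_zero]) hε0 hε m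
  have hsub : (Finset.univ.filter fun x : Fin m → X => m * ε ≤ |∑ i, f (x i) - m * μ|) ⊆
      (Finset.univ.filter fun x : Fin m → X => m * ε ≤ ∑ i, (f (x i) - μ)) ∪
      (Finset.univ.filter fun x : Fin m → X => m * ε ≤ ∑ i, -(f (x i) - μ)) := by
    intro x hx
    have hx' := (Finset.mem_filter.1 hx).2
    simp only [Finset.mem_union, Finset.mem_filter, Finset.mem_univ, true_and,
      Finset.sum_neg_distrib, Finset.sum_sub_distrib, Finset.sum_const, Finset.card_univ,
      Fintype.card_fin, nsmul_eq_mul]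
    exact le_abs.1 hx'
  have h3 : ((Finset.univ.filter fun x : Fin m → X =>
      m * ε ≤ |∑ i, f (x i) - m * μ|).card : ℝ) ≤ _ :=
    Nat.cast_le.2 ((Finset.card_le_card hsub).trans (Finset.card_union_le _ _))
  push_cast at h3
  linarith

open Classical in
/-- All sample means in a finite family are simultaneously close to the true means. -/
theorem card_exists_sample_mean_far_le [Nonempty X] {J : Type*} (s : Finset J) (f : J → X → ℝ)
    (hf : ∀ j x, f j x ∈ Set.Icc (0 : ℝ) 1) {μ : J → ℝ}
    (hμ : ∀ j, ∑ x, f j x = Fintype.card X * μ j) {ε η : ℝ} (hε0 : 0 < ε) (hε : ε ≤ 1)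
    (hη : 0 < η) {m : ℕ} (hs : s.Nonempty)
    (hm : 4 / ε ^ 2 * Real.log (2 * s.card / η) ≤ m) :
    ((Finset.univ.filter fun x : Fin m → X =>
        ∃ j ∈ s, m * ε ≤ |∑ i, f j (x i) - m * μ j|).card : ℝ) ≤
      (Fintype.card X : ℝ) ^ m * η := by
  have hcard : (0 : ℝ) < s.card := by exact_mod_cast hs.card_pos
  -- The total failure rate in the union bound; the lower bound on `m` is chosen for this.
  have hexp : s.card * (2 * Real.exp (-(m * ε ^ 2 / 4))) ≤ η := by
    have h1 : Real.log (2 * s.card / η) ≤ m * ε ^ 2 / 4 := by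
      have : Real.log (2 * s.card / η) = 4 / ε ^ 2 * Real.log (2 * s.card / η) * (ε ^ 2 / 4) := by
        field_simp
      rw [this]
      refine (mul_le_mul_of_nonneg_right hm (by positivity)).trans (le_of_eq (by ring))
    have h2 : Real.exp (-(m * ε ^ 2 / 4)) ≤ (2 * s.card / η)⁻¹ := by
      rw [← Real.exp_log (by positivity : 0 < 2 * (s.card : ℝ) / η), ← Real.exp_neg]
      exact Real.exp_le_exp.2 (neg_le_neg h1)
    calc s.card * (2 * Real.exp (-(m * ε ^ 2 / 4))) ≤ s.card * (2 * (2 * s.card / η)⁻¹) := by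
          gcongr
      _ = η := by field_simp
  have hsub : (Finset.univ.filter fun x : Fin m → X =>
        ∃ j ∈ s, m * ε ≤ |∑ i, f j (x i) - m * μ j|) ⊆
      s.biUnion fun j => Finset.univ.filter fun x : Fin m → X =>
        m * ε ≤ |∑ i, f j (x i) - m * μ j| := by
    intro x hx
    simpa using hx
  calc _ ≤ (∑ j ∈ s, ((Finset.univ.filter fun x : Fin m → X =>
        m * ε ≤ |∑ i, f j (x i) - m * μ j|).card : ℝ)) := by
        exact_mod_cast (Finset.card_le_card hsub).trans Finset.card_biUnion_le
    _ ≤ ∑ _j ∈ s, (Fintype.card X : ℝ) ^ m * (2 * Real.exp (-(m * ε ^ 2 / 4))) :=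
        Finset.sum_le_sum fun j _ => card_sample_mean_far_le (f j) (hf j) (hμ j) hε0.le hε m
    _ = (Fintype.card X : ℝ) ^ m * (s.card * (2 * Real.exp (-(m * ε ^ 2 / 4)))) := by
        rw [Finset.sum_const, nsmul_eq_mul]
        ring
    _ ≤ _ := mul_le_mul_of_nonneg_left hexp (by positivity)

end Sampling

/-! ## Grids -/

/-- Cut the parameter space into cells of side `ρ` and keep one element of `S` from each cell that
meets its image. Choosing representatives, not grid points, keeps the net inside `S`. -/
theorem exists_finset_cover_of_bounded {X : Type*} {d : ℕ} (S : Set X) (φ : X → Fin d → ℝ)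
    {R ρ : ℝ} (hR : 0 ≤ R) (hρ : 0 < ρ) (hφ : ∀ x ∈ S, ∀ i, |φ x i| ≤ R) :
    ∃ t : Finset X, (∀ x ∈ t, x ∈ S) ∧ (t.card : ℝ) ≤ (2 * R / ρ + 2) ^ d ∧
      ∀ x ∈ S, ∃ y ∈ t, ∀ i, |φ x i - φ y i| ≤ ρ := by
  classical
  rcases isEmpty_or_nonempty X with hX | hX
  · exact ⟨∅, by simp, by rw [Finset.card_empty, Nat.cast_zero]; positivity, fun x => hX.elim x⟩
  let cell : X → Fin d → ℤ := fun x i => ⌊φ x i / ρ⌋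
  let I : Finset ℤ := Finset.Icc ⌊-R / ρ⌋ ⌊R / ρ⌋
  let G : Finset (Fin d → ℤ) := (Fintype.piFinset fun _ => I).filter fun u => ∃ x ∈ S, cell x = u
  have hG : ∀ u ∈ G, ∃ x ∈ S, cell x = u := fun u hu => (Finset.mem_filter.1 hu).2
  choose! r hr using hG
  refine ⟨G.image r, ?_, ?_, ?_⟩
  · intro x hx
    obtain ⟨u, hu, rfl⟩ := Finset.mem_image.1 hx
    exact (hr u hu).1
  · have hI : (I.card : ℝ) ≤ 2 * R / ρ + 2 := by
      have h0 : 0 ≤ R / ρ := by positivity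
      have h1 : (⌊-R / ρ⌋ : ℝ) ≤ ⌊R / ρ⌋ + 1 := by
        have := Int.floor_le (-R / ρ)
        have := Int.lt_floor_add_one (R / ρ)
        have h3 : -R / ρ = -(R / ρ) := by ring
        linarith
      have h2 : ((I.card : ℤ) : ℝ) = ⌊R / ρ⌋ + 1 - ⌊-R / ρ⌋ := by
        rw [Int.card_Icc_of_le _ _ (by exact_mod_cast h1)]
        push_cast
        ring
      have h3 := Int.floor_le (R / ρ)
      have h4 := Int.lt_floor_add_one (-R / ρ)
      have h5 : -R / ρ = -(R / ρ) := by ring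
      have h6 : 2 * R / ρ = R / ρ + R / ρ := by ring
      have h7 : ((I.card : ℤ) : ℝ) = I.card := by simp
      linarith
    have h1 : (G.image r).card ≤ I.card ^ d := by
      refine Finset.card_image_le.trans ((Finset.card_filter_le _ _).trans (le_of_eq ?_))
      simp
    calc ((G.image r).card : ℝ) ≤ (I.card : ℝ) ^ d := by exact_mod_cast h1
      _ ≤ _ := pow_le_pow_left₀ (Nat.cast_nonneg _) hI d
  · intro x hx
    have hu : cell x ∈ G := by
      refine Finset.mem_filter.2 ⟨Fintype.mem_piFinset.2 fun i => ?_, x, hx, rfl⟩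
      have := abs_le.1 (hφ x hx i)
      refine Finset.mem_Icc.2 ⟨Int.floor_le_floor ?_, Int.floor_le_floor ?_⟩
      · exact div_le_div_of_nonneg_right this.1 hρ.le
      · exact div_le_div_of_nonneg_right this.2 hρ.le
    refine ⟨r (cell x), Finset.mem_image_of_mem _ hu, fun i => ?_⟩
    have h1 : ⌊φ (r (cell x)) i / ρ⌋ = ⌊φ x i / ρ⌋ := congrFun (hr _ hu).2 i
    have h2 := Int.abs_sub_lt_one_of_floor_eq_floor h1.symm
    rw [← sub_div, abs_div, abs_of_pos hρ, div_lt_one hρ] at h2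
    exact h2.le

theorem max_one_one_div_pow (δ : ℝ) (d : ℕ) :
    (max 1 (1 / δ)) ^ d ≤ max 1 (1 / δ ^ d) := by
  rcases le_total 1 (1 / δ) with h | h
  · rw [max_eq_right h, one_div_pow]
    exact le_max_right _ _
  · rw [max_eq_left h, one_pow]
    exact le_max_left _ _

theorem div_add_two_pow_le {a δ : ℝ} (ha : 0 ≤ a) (hδ : 0 < δ) (d : ℕ) :
    (a / δ + 2) ^ d ≤ (a + 2) ^ d * max 1 (1 / δ ^ d) := by
  have h1 : a / δ ≤ a * max 1 (1 / δ) := by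
    rw [div_eq_mul_one_div]
    exact mul_le_mul_of_nonneg_left (le_max_right _ _) ha
  calc (a / δ + 2) ^ d ≤ ((a + 2) * max 1 (1 / δ)) ^ d := by
        refine pow_le_pow_left₀ (by positivity) ?_ d
        linarith [le_max_left 1 (1 / δ)]
    _ ≤ _ := by
        rw [mul_pow]
        exact mul_le_mul_of_nonneg_left (max_one_one_div_pow δ d) (by positivity)

theorem exists_intensityCover {c δ : ℝ} (hc : 1 ≤ c) (hδ : 0 < δ) :
    ∃ ℬ : Finset Intensity, IsIntensityCover c δ ℬ ∧
      (ℬ.card : ℝ) ≤ (4 * c + 2) ^ 2 * max 1 (1 / δ ^ 2) := by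
  -- On `[0, 1]` contrast and brightness each contribute at most `δ / 2`; truncation does not
  -- increase differences.
  obtain ⟨ℬ, h1, h2, h3⟩ := exists_finset_cover_of_bounded (intensityFamily c)
    (fun L => ![L.con, L.bri]) (R := c) (ρ := δ / 2) (by linarith) (by linarith) (by
      rintro L ⟨⟨h1, h2⟩, h3, h4⟩ i
      have h0 : 0 ≤ 1 / c := by positivity
      fin_cases i
      · show |L.con| ≤ c
        rw [abs_le]
        constructor <;> linarith
      · show |L.bri| ≤ c
        rw [abs_le]
        constructor <;> linarith)
  refine ⟨ℬ, ⟨h1, fun L hL => ?_⟩, h2.trans ?_⟩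
  · obtain ⟨L', hL', h⟩ := h3 L hL
    refine ⟨L', hL', fun v hv => (abs_clamp_sub_clamp_le _ _).trans ?_⟩
    have e0 : |L.con - L'.con| ≤ δ / 2 := h 0
    have e1 : |L.bri - L'.bri| ≤ δ / 2 := h 1
    calc |L.con * v + L.bri - (L'.con * v + L'.bri)|
        = |(L.con - L'.con) * v + (L.bri - L'.bri)| := by ring_nf
      _ ≤ |L.con - L'.con| * v + |L.bri - L'.bri| := by
          refine (abs_add_le _ _).trans (le_of_eq ?_)
          rw [abs_mul, abs_of_nonneg hv.1]
      _ ≤ |L.con - L'.con| * 1 + |L.bri - L'.bri| := by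
          gcongr
          exact hv.2
      _ ≤ δ := by linarith
  · rw [show 2 * c / (δ / 2) = 4 * c / δ by field_simp; norm_num]
    exact div_add_two_pow_le (by linarith) hδ 2

/-- Some pixel lands in the image and lies within `2 n` of the corner, so the corner lands within `2
c n` of the image. This bounds the translations, making a finite cover possible. -/
theorem abs_apply_base_le_of_hitsImage {n : ℕ} (hn : 0 < n) {c : ℝ} (hc : 1 ≤ c) {T : PlaneAffine}
    (hT : T ∈ affineFamily c) (hhit : HitsImage n T) (j : Fin 2) :
    |T !₂[1, 1] j| ≤ 4 * c * n := by
  obtain ⟨p, hp, hq⟩ := hhit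
  have hn' : (1 : ℝ) ≤ n := by exact_mod_cast hn
  have h1 : |T (pixelPoint p) j| ≤ n + 1 := by
    have h : 1 ≤ ⌊T (pixelPoint p) j⌋ ∧ ⌊T (pixelPoint p) j⌋ ≤ n := by
      have := mem_pixels.1 hq
      fin_cases j
      · exact this.1
      · exact this.2
    have h2 := Int.floor_le (T (pixelPoint p) j)
    have h3 := Int.lt_floor_add_one (T (pixelPoint p) j)
    have h4 : (1 : ℝ) ≤ ⌊T (pixelPoint p) j⌋ := by exact_mod_cast h.1
    have h5 : (⌊T (pixelPoint p) j⌋ : ℝ) ≤ n := by exact_mod_cast h.2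
    rw [abs_le]
    constructor <;> linarith
  have h2 : ‖pixelPoint p - !₂[1, 1]‖ ≤ 2 * n := by
    refine (Plane.norm_le _).trans ?_
    have e0 := pixelPoint_mem hp 0
    have e1 := pixelPoint_mem hp 1
    have f0 : |(pixelPoint p - !₂[1, 1] : Plane) 0| ≤ n := by
      rw [PiLp.sub_apply, abs_le]
      simp only [Matrix.cons_val_zero]
      constructor <;> linarith [e0.1, e0.2]
    have f1 : |(pixelPoint p - !₂[1, 1] : Plane) 1| ≤ n := by
      rw [PiLp.sub_apply, abs_le]
      simp only [Matrix.cons_val_one, Matrix.cons_val_fin_one]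
      constructor <;> linarith [e1.1, e1.2]
    linarith
  have h3 := T.linearMap_vsub (pixelPoint p) !₂[1, 1]
  rw [vsub_eq_sub, vsub_eq_sub] at h3
  have h4 : |(T (pixelPoint p) - T !₂[1, 1]) j| ≤ c * (2 * n) := by
    rw [← h3]
    refine (Plane.abs_apply_le_norm _ j).trans ((hT _).2.trans ?_)
    exact mul_le_mul_of_nonneg_left h2 (by linarith)
  rw [PiLp.sub_apply] at h4
  rw [abs_le] at h1 h4 ⊢
  constructor <;> nlinarith

theorem exists_affineCover {c δ : ℝ} (hc : 1 ≤ c) (hδ : 0 < δ) {n : ℕ} (hn : 0 < n) :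
    ∃ 𝒯 : Finset PlaneAffine, IsAffineCover c n (δ * n) 𝒯 ∧
      (𝒯.card : ℝ) ≤ (48 * c + 2) ^ 6 * max 1 (1 / δ ^ 6) := by
  have hn' : (0 : ℝ) < n := by exact_mod_cast hn
  let e : Fin 2 → Plane := fun i => EuclideanSpace.single i (1 : ℝ)
  have hentry : ∀ T ∈ affineFamily c, ∀ i j, |T.linear (e i) j| ≤ 4 * c := by
    intro T hT i j
    refine (Plane.abs_apply_le_norm _ j).trans ((hT _).2.trans ?_)
    simp only [e, PiLp.norm_single, norm_one, mul_one]
    linarith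
  -- The parameters are the four matrix entries and the image of the corner, rescaled by `n`.
  -- Precision `δ / 6` gives an error of `δ n / 3` from each column and from the corner.
  obtain ⟨𝒯, h1, h2, h3⟩ := exists_finset_cover_of_bounded {T ∈ affineFamily c | HitsImage n T}
    (fun T => ![T.linear (e 0) 0, T.linear (e 0) 1, T.linear (e 1) 0, T.linear (e 1) 1,
      T !₂[1, 1] 0 / n, T !₂[1, 1] 1 / n]) (R := 4 * c) (ρ := δ / 6) (by linarith) (by linarith) (by
      rintro T ⟨hT, hhit⟩ i
      have hbase : ∀ j, |T !₂[1, 1] j / n| ≤ 4 * c := fun j => by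
        rw [abs_div, abs_of_pos hn', div_le_iff₀ hn']
        exact abs_apply_base_le_of_hitsImage hn hc hT hhit j
      fin_cases i
      exacts [hentry T hT 0 0, hentry T hT 0 1, hentry T hT 1 0, hentry T hT 1 1, hbase 0, hbase 1])
  refine ⟨𝒯, ⟨fun T hT => (h1 T hT).1, fun A hA hhit => ?_⟩, h2.trans ?_⟩
  · obtain ⟨T, hT, h⟩ := h3 A ⟨hA, hhit⟩
    refine ⟨T, hT, fun x hx => ?_⟩
    set D : PlaneAffine := A - T with hDdef
    have hD : ∀ y, D y = A y - T y := fun y => rfl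
    have hcol : ∀ i, ‖D.linear (e i)‖ ≤ δ / 3 := by
      intro i
      have hl : ∀ j, D.linear (e i) j = A.linear (e i) j - T.linear (e i) j := fun j => rfl
      refine (Plane.norm_le _).trans ?_
      rw [hl, hl]
      have g0 : |A.linear (e 0) 0 - T.linear (e 0) 0| ≤ δ / 6 := h 0
      have g1 : |A.linear (e 0) 1 - T.linear (e 0) 1| ≤ δ / 6 := h 1
      have g2 : |A.linear (e 1) 0 - T.linear (e 1) 0| ≤ δ / 6 := h 2
      have g3 : |A.linear (e 1) 1 - T.linear (e 1) 1| ≤ δ / 6 := h 3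
      fin_cases i <;> simp only [Fin.zero_eta, Fin.mk_one] <;> linarith
    have hbase : ‖D !₂[1, 1]‖ ≤ δ / 3 * n := by
      refine (Plane.norm_le _).trans ?_
      have g4 : |A !₂[1, 1] 0 / n - T !₂[1, 1] 0 / n| ≤ δ / 6 := h 4
      have g5 : |A !₂[1, 1] 1 / n - T !₂[1, 1] 1 / n| ≤ δ / 6 := h 5
      rw [← sub_div, abs_div, abs_of_pos hn', div_le_iff₀ hn'] at g4 g5
      rw [hD, PiLp.sub_apply, PiLp.sub_apply]
      linarith
    have hcoord : ∀ i, |(x - !₂[1, 1] : Plane) i| ≤ n := by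
      intro i
      obtain ⟨hx1, hx2⟩ := hx i
      rw [PiLp.sub_apply, abs_le]
      fin_cases i <;> simp at hx1 hx2 ⊢ <;> constructor <;> linarith
    have hlin : ‖D.linear (x - !₂[1, 1])‖ ≤ n * (δ / 3) + n * (δ / 3) := by
      rw [Plane.eq_smul_single_add (x - !₂[1, 1]), map_add, map_smul, map_smul]
      refine (norm_add_le _ _).trans ?_
      rw [norm_smul, norm_smul, Real.norm_eq_abs, Real.norm_eq_abs]
      exact add_le_add
        (mul_le_mul (hcoord 0) (hcol 0) (norm_nonneg _) hn'.le)
        (mul_le_mul (hcoord 1) (hcol 1) (norm_nonneg _) hn'.le)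
    have hx : D x = D !₂[1, 1] + D.linear (x - !₂[1, 1]) := by
      have := D.linearMap_vsub x !₂[1, 1]
      rw [vsub_eq_sub, vsub_eq_sub] at this
      rw [this]
      abel
    rw [dist_eq_norm, ← hD, hx]
    refine (norm_add_le _ _).trans ?_
    linarith
  · rw [show 2 * (4 * c) / (δ / 6) = 48 * c / δ by field_simp; norm_num]
    exact div_add_two_pow_le (by linarith) hδ 6

/-! ## Query algorithms -/

/-- The answer to a query. -/
def oracle {n : ℕ} (M₁ M₂ : GrayImage n) (q : Bool × Pixel n) : Set.Icc (0 : ℝ) 1 :=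
  if q.1 then M₂ q.2 else M₁ q.2

/-- Makes the queries of a list, overwriting the table `I` with the answers, and outputs the value
of `f` at the resulting table. -/
noncomputable def QueryAlg.queryList {n : ℕ} {R : Type}
    (f : (Bool × Pixel n → Set.Icc (0 : ℝ) 1) → R) :
    List (Bool × Pixel n) → (Bool × Pixel n → Set.Icc (0 : ℝ) 1) → QueryAlg n R
  | [], I => .output (f I)
  | q :: l, I => .query q.1 q.2 fun v => QueryAlg.queryList f l (Function.update I q v)

theorem QueryAlg.queryCount_queryList {n : ℕ} {R : Type}
    (f : (Bool × Pixel n → Set.Icc (0 : ℝ) 1) → R) (l : List (Bool × Pixel n))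
    (I : Bool × Pixel n → Set.Icc (0 : ℝ) 1) (M₁ M₂ : GrayImage n) :
    (QueryAlg.queryList f l I).queryCount M₁ M₂ = l.length := by
  induction l generalizing I with
  | nil => rfl
  | cons q l ih => exact congrArg (· + 1) (ih _)

/-- Entries are overwritten only by true answers, so a correct entry stays correct. The alternative
that the initial table is already right carries the induction. -/
theorem QueryAlg.exists_run_queryList_eq {n : ℕ} {R : Type}
    (f : (Bool × Pixel n → Set.Icc (0 : ℝ) 1) → R) (l : List (Bool × Pixel n))
    (I : Bool × Pixel n → Set.Icc (0 : ℝ) 1) (M₁ M₂ : GrayImage n) :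
    ∃ J : Bool × Pixel n → Set.Icc (0 : ℝ) 1,
      (∀ q, q ∈ l ∨ I q = oracle M₁ M₂ q → J q = oracle M₁ M₂ q) ∧
        (QueryAlg.queryList f l I).run M₁ M₂ = f J := by
  induction l generalizing I with
  | nil => exact ⟨I, by simp, rfl⟩
  | cons q l ih =>
    obtain ⟨J, hJ, hrun⟩ := ih (Function.update I q (oracle M₁ M₂ q))
    refine ⟨J, fun r hr => hJ r ?_, hrun⟩
    rcases eq_or_ne r q with rfl | hrq
    · exact Or.inr (Function.update_self _ _ _)
    · rw [Function.update_of_ne hrq]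
      simpa [hrq] using hr

/-- The sum of the mismatches over a sample of pixels. -/
noncomputable def sampleMismatch {n m : ℕ} (x : Fin m → Pixel n) (M₁ M₂ : GrayImage n)
    (j : PlaneAffine × Intensity) : ℝ :=
  ∑ i, mismatch j.2 M₂ (M₁ (x i)) (imageAffine j.1 (x i).1)

open Classical in
/-- The queries from which the mismatches of a sample are computed. -/
noncomputable def sampleQueries {n m : ℕ} (𝒯 : Finset PlaneAffine) (x : Fin m → Pixel n) :
    Finset (Bool × Pixel n) :=
  (Finset.univ.image fun i => (false, x i)) ∪
    (𝒯 ×ˢ Finset.univ).image fun a : PlaneAffine × Fin m =>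
      -- For a pixel mapped out of the image the query is a dummy.
      (true, if h : imageAffine a.1 (x a.2).1 ∈ pixels n then ⟨_, h⟩ else x a.2)

theorem card_sampleQueries_le {n m : ℕ} (𝒯 : Finset PlaneAffine) (x : Fin m → Pixel n) :
    (sampleQueries 𝒯 x).card ≤ m * (1 + 𝒯.card) := by
  refine (Finset.card_union_le _ _).trans ?_
  have h1 := Finset.card_image_le (s := Finset.univ) (f := fun i => (false, x i))
  have h2 := Finset.card_image_le (s := 𝒯 ×ˢ Finset.univ) (f := fun a : PlaneAffine × Fin m =>
    (true, if h : imageAffine a.1 (x a.2).1 ∈ pixels n then (⟨_, h⟩ : Pixel n) else x a.2))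
  rw [Finset.card_product] at h2
  rw [Finset.card_univ, Fintype.card_fin] at h1 h2
  rw [mul_add, mul_one, mul_comm m]
  exact add_le_add h1 h2

theorem sampleMismatch_congr {n m : ℕ} {𝒯 : Finset PlaneAffine} {x : Fin m → Pixel n}
    {M₁ M₂ : GrayImage n} {J : Bool × Pixel n → Set.Icc (0 : ℝ) 1}
    (hJ : ∀ q ∈ sampleQueries 𝒯 x, J q = oracle M₁ M₂ q) {j : PlaneAffine × Intensity}
    (hj : j.1 ∈ 𝒯) :
    sampleMismatch x (fun p => J (false, p)) (fun p => J (true, p)) j =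
      sampleMismatch x M₁ M₂ j := by
  classical
  refine Finset.sum_congr rfl fun i _ => ?_
  have h1 : J (false, x i) = M₁ (x i) :=
    hJ _ (Finset.mem_union_left _ (Finset.mem_image_of_mem _ (Finset.mem_univ i)))
  simp only [h1]
  unfold mismatch
  split_ifs with h
  · have h2 : J (true, ⟨imageAffine j.1 (x i).1, h⟩) = M₂ ⟨imageAffine j.1 (x i).1, h⟩ :=
      hJ _ (Finset.mem_union_right _ (Finset.mem_image.2
        ⟨(j.1, i), Finset.mem_product.2 ⟨hj, Finset.mem_univ i⟩, by simp [h]⟩))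
    simp only [h2]
  · rfl

/-- From a sample of pixels one finds, with few queries, a pair whose mismatch on the sample is
minimal. -/
theorem exists_queryAlg_minimizing_sampleMismatch {n m : ℕ} {𝒯 : Finset PlaneAffine}
    {ℬ : Finset Intensity} (h𝒯 : 𝒯.Nonempty) (hℬ : ℬ.Nonempty) (x : Fin m → Pixel n) :
    ∃ a : QueryAlg n (PlaneAffine × Intensity), ∀ M₁ M₂ : GrayImage n,
      a.queryCount M₁ M₂ ≤ m * (1 + 𝒯.card) ∧ a.run M₁ M₂ ∈ 𝒯 ×ˢ ℬ ∧
        ∀ j ∈ 𝒯 ×ˢ ℬ, sampleMismatch x M₁ M₂ (a.run M₁ M₂) ≤ sampleMismatch x M₁ M₂ j := by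
  have hmin : ∀ J : Bool × Pixel n → Set.Icc (0 : ℝ) 1, ∃ j ∈ 𝒯 ×ˢ ℬ, ∀ j' ∈ 𝒯 ×ˢ ℬ,
      sampleMismatch x (fun p => J (false, p)) (fun p => J (true, p)) j ≤
        sampleMismatch x (fun p => J (false, p)) (fun p => J (true, p)) j' := fun J =>
    Finset.exists_min_image _ _ (h𝒯.product hℬ)
  choose f hf hfmin using hmin
  -- The initial table is arbitrary: the sample mismatches for maps in `𝒯` read only queried
  -- entries.
  refine ⟨QueryAlg.queryList f (sampleQueries 𝒯 x).toList fun _ => 0, fun M₁ M₂ => ⟨?_, ?_⟩⟩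
  · rw [QueryAlg.queryCount_queryList, Finset.length_toList]
    exact card_sampleQueries_le 𝒯 x
  · obtain ⟨J, hJ, hrun⟩ := QueryAlg.exists_run_queryList_eq f (sampleQueries 𝒯 x).toList
      (fun _ => 0) M₁ M₂
    have hJ' : ∀ q ∈ sampleQueries 𝒯 x, J q = oracle M₁ M₂ q := fun q hq =>
      hJ q (Or.inl (Finset.mem_toList.2 hq))
    rw [hrun]
    refine ⟨hf J, fun j hj => ?_⟩
    have h := hfmin J j hj
    rwa [sampleMismatch_congr hJ' (Finset.mem_product.1 (hf J)).1,
      sampleMismatch_congr hJ' (Finset.mem_product.1 hj).1] at h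

/-! ### Success probability, sample size and the main theorem. -/

theorem ofReal_one_sub_le_toOuterMeasure_map_uniform {Y A : Type*} [Fintype Y] [Nonempty Y]
    (a : Y → A) (S : Set A) {η : ℝ} (bad : Finset Y)
    (hbad : (bad.card : ℝ) ≤ Fintype.card Y * η) (h : ∀ y, y ∉ bad → a y ∈ S) :
    ENNReal.ofReal (1 - η) ≤ ((PMF.uniformOfFintype Y).map a).toOuterMeasure S := by
  classical
  have hY : (0 : ℝ) < Fintype.card Y := by exact_mod_cast Fintype.card_pos
  have hsub : ((badᶜ : Finset Y) : Set Y) ⊆ a ⁻¹' S := fun y hy =>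
    h y (Finset.mem_compl.1 (Finset.mem_coe.1 hy))
  rw [PMF.toOuterMeasure_map_apply]
  refine le_trans ?_ ((PMF.uniformOfFintype Y).toOuterMeasure.mono hsub)
  have hcard : ((badᶜ : Finset Y).card : ℝ) = Fintype.card Y - bad.card := by
    rw [Finset.card_compl, Nat.cast_sub (Finset.card_le_univ _)]
  have hval : (PMF.uniformOfFintype Y).toOuterMeasure ((badᶜ : Finset Y) : Set Y) =
      ENNReal.ofReal (((badᶜ : Finset Y).card : ℝ) / Fintype.card Y) := by
    rw [PMF.toOuterMeasure_uniformOfFintype_apply, ENNReal.ofReal_div_of_pos hY,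
      ENNReal.ofReal_natCast, ENNReal.ofReal_natCast]
    congr 2
    exact Fintype.card_coe _
  show _ ≤ (PMF.uniformOfFintype Y).toOuterMeasure ((badᶜ : Finset Y) : Set Y)
  rw [hval]
  refine ENNReal.ofReal_le_ofReal ?_
  rw [hcard, le_div_iff₀ hY]
  linarith

theorem sampleSize_mul_le {B ε δ η s t : ℝ} (hB : 1 ≤ B) (hε : 0 < ε) (hε1 : ε ≤ 1) (hδ : 0 < δ)
    (hδ1 : δ ≤ 1) (hη : 0 < η) (hη1 : η < 1) (ht : 1 ≤ t) (ht' : t ≤ B * (1 / δ ^ 6))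
    (hs : 1 ≤ s) (hs' : s ≤ B * (1 / δ ^ 2)) :
    (⌈4 / ε ^ 2 * Real.log (2 * (t * s) / η)⌉₊ : ℝ) * (1 + t) ≤
      2 * B * (16 * B + 70) * (1 / (ε ^ 2 * δ ^ 8)) * Real.log (2 + 1 / (ε * δ)) ^ 1 *
        Real.log (2 / η) := by
  set X := Real.log (2 + 1 / (ε * δ))
  set Y := Real.log (2 / η)
  have hX' : 1 / δ ≤ 1 / (ε * δ) :=
    one_div_le_one_div_of_le (by positivity) (mul_le_of_le_one_left hδ.le hε1)
  have hδ' : 1 ≤ 1 / δ := (one_le_div hδ).2 hδ1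
  have hX : 1 ≤ X := by
    rw [Real.le_log_iff_exp_le (by positivity)]
    linarith [Real.exp_one_lt_d9]
  have hXδ : Real.log (1 / δ) ≤ X :=
    Real.log_le_log (by positivity) (by linarith)
  have hY : 1 / 2 ≤ Y := by
    have h1 : Real.log 2 ≤ Y := Real.log_le_log (by norm_num) (by
      rw [le_div_iff₀ hη]
      linarith)
    linarith [Real.log_two_gt_d9]
  -- With `X ≥ 1` and `Y ≥ 1 / 2`, constants and single logarithms are all absorbed into multiples
  -- of `X * Y`.
  have hXY : X ≤ 2 * (X * Y) := by nlinarith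
  have hXY1 : 1 ≤ 2 * (X * Y) := hX.trans hXY
  have hYX : Y ≤ X * Y := by nlinarith
  have hts : t * s ≤ B ^ 2 * (1 / δ) ^ 8 := by
    calc t * s ≤ B * (1 / δ ^ 6) * (B * (1 / δ ^ 2)) :=
          mul_le_mul ht' hs' (by linarith) (by positivity)
      _ = _ := by
          field_simp
  have hlog : Real.log (2 * (t * s) / η) ≤ (4 * B + 17) * (X * Y) := by
    have h1 : 2 * (t * s) / η ≤ B ^ 2 * (1 / δ) ^ 8 * (2 / η) := by
      rw [mul_comm 2, mul_div_assoc]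
      exact mul_le_mul_of_nonneg_right hts (by positivity)
    have h2 : Real.log (B ^ 2 * (1 / δ) ^ 8 * (2 / η)) =
        2 * Real.log B + 8 * Real.log (1 / δ) + Y := by
      rw [Real.log_mul (by positivity) (by positivity), Real.log_mul (by positivity) (by positivity),
        Real.log_pow, Real.log_pow]
      norm_num
      rfl
    have h3 : Real.log B ≤ B := (Real.log_le_sub_one_of_pos (by linarith)).trans (by linarith)
    have h4 : B ≤ B * (2 * (X * Y)) := le_mul_of_one_le_right (by linarith) hXY1
    calc Real.log (2 * (t * s) / η) ≤ 2 * Real.log B + 8 * Real.log (1 / δ) + Y := by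
          rw [← h2]
          exact Real.log_le_log (by positivity) h1
      _ ≤ 2 * (B * (2 * (X * Y))) + 8 * (2 * (X * Y)) + X * Y := by linarith
      _ = _ := by ring
  have hlog0 : 0 ≤ Real.log (2 * (t * s) / η) := by
    refine Real.log_nonneg ?_
    rw [le_div_iff₀ hη]
    nlinarith
  have hε' : 1 ≤ 1 / ε ^ 2 := (one_le_div (by positivity)).2 (pow_le_one₀ hε.le hε1)
  have hm : (⌈4 / ε ^ 2 * Real.log (2 * (t * s) / η)⌉₊ : ℝ) ≤
      1 / ε ^ 2 * ((16 * B + 70) * (X * Y)) := by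
    have h1 := (Nat.ceil_lt_add_one
      (show 0 ≤ 4 / ε ^ 2 * Real.log (2 * (t * s) / η) by positivity)).le
    have h2 : 4 / ε ^ 2 * Real.log (2 * (t * s) / η) ≤
        1 / ε ^ 2 * (4 * ((4 * B + 17) * (X * Y))) := by
      rw [div_eq_mul_one_div, mul_comm 4, mul_assoc]
      gcongr
    have h3 : 1 ≤ 1 / ε ^ 2 * (2 * (X * Y)) := one_le_mul_of_one_le_of_one_le hε' hXY1
    calc _ ≤ _ := h1
      _ ≤ 1 / ε ^ 2 * (4 * ((4 * B + 17) * (X * Y))) + 1 / ε ^ 2 * (2 * (X * Y)) :=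
          add_le_add h2 h3
      _ = _ := by ring
  -- The bound is generous: `δ ^ 6` would do here.
  have ht2 : 1 + t ≤ 2 * B * (1 / δ ^ 8) := by
    have h1 : 1 / δ ^ 6 ≤ 1 / δ ^ 8 :=
      one_div_le_one_div_of_le (by positivity) (pow_le_pow_of_le_one hδ.le hδ1 (by norm_num))
    nlinarith
  calc _ ≤ 1 / ε ^ 2 * ((16 * B + 70) * (X * Y)) * (2 * B * (1 / δ ^ 8)) :=
        mul_le_mul hm ht2 (by linarith) (by positivity)
    _ = _ := by
        rw [pow_one]
        field_simp

theorem mainTheorem3 (c : ℝ) (hc : 1 ≤ c) :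
    ∃ (C : ℝ) (k : ℕ) (B₀ : ℝ), ∀ B : ℝ, B₀ ≤ B → ∃ K : ℝ,
      ∀ (n : ℕ) (δ : ℝ), 0 < δ → 1 ≤ δ * n →
        (∃ (𝒯 : Finset PlaneAffine) (ℬ : Finset Intensity),
          IsAffineCover c n (δ * n) 𝒯 ∧ (𝒯.card : ℝ) ≤ B * max 1 (1 / δ ^ 6) ∧
          IsIntensityCover c δ ℬ ∧ (ℬ.card : ℝ) ≤ B * max 1 (1 / δ ^ 2)) ∧
        ∀ (𝒯 : Finset PlaneAffine) (ℬ : Finset Intensity),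
          IsAffineCover c n (δ * n) 𝒯 → (𝒯.card : ℝ) ≤ B * max 1 (1 / δ ^ 6) →
          IsIntensityCover c δ ℬ → (ℬ.card : ℝ) ≤ B * max 1 (1 / δ ^ 2) →
          ∀ ε η : ℝ, 0 < ε → 0 < η → η < 1 →
            ∃ 𝒜 : PMF (QueryAlg n (PlaneAffine × Intensity)),
              (∀ a ∈ 𝒜.support, ∀ M₁ M₂ : GrayImage n,
                (a.queryCount M₁ M₂ : ℝ) ≤
                  K * (1 / (ε ^ 2 * δ ^ 8)) * Real.log (2 + 1 / (ε * δ)) ^ k *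
                    Real.log (2 / η)) ∧
              ∀ M₁ M₂ : GrayImage n,
                ENNReal.ofReal (1 - η) ≤ 𝒜.toOuterMeasure
                  {a | (a.run M₁ M₂).1 ∈ 𝒯 ∧ (a.run M₁ M₂).2 ∈ ℬ ∧
                    |imageDistWith (a.run M₁ M₂).1 (a.run M₁ M₂).2 M₁ M₂ - imageDist c M₁ M₂| ≤
                      C * (δ / n * max (GrayImage.perimeter M₁) (GrayImage.perimeter M₂) + ε)} := by
  classical
  set Q : ℝ := 6 * c * (2 * ⌈4 * c⌉₊ + 1 : ℝ) ^ 2 + 1 with hQdef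
  have hQ : 0 ≤ Q := by positivity
  -- `Q` is the loss from the covers, `2` the two sampling errors, and `16 * c` serves the case of
  -- large `δ`. The threshold for `B` is the constant of the affine cover, which exceeds that of the
  -- intensity cover.
  refine ⟨Q + 16 * c + 2, 1, (48 * c + 2) ^ 6, fun B hB => ⟨2 * B * (16 * B + 70), ?_⟩⟩
  intro n δ hδ hδn
  have hn : 0 < n := by
    rcases Nat.eq_zero_or_pos n with rfl | h
    · norm_num at hδn
    · exact h
  have hn' : (0 : ℝ) < n := by exact_mod_cast hn
  have hB2 : (4 * c + 2) ^ 2 ≤ B :=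
    calc (4 * c + 2) ^ 2 ≤ (48 * c + 2) ^ 2 := by gcongr; norm_num
      _ ≤ (48 * c + 2) ^ 6 := pow_le_pow_right₀ (by linarith) (by norm_num)
      _ ≤ B := hB
  have hB1 : 1 ≤ B := (one_le_pow₀ (by linarith)).trans hB2
  refine ⟨?_, ?_⟩
  · obtain ⟨𝒯, h1, h2⟩ := exists_affineCover hc hδ hn
    obtain ⟨ℬ, h3, h4⟩ := exists_intensityCover hc hδ
    refine ⟨𝒯, ℬ, h1, h2.trans ?_, h3, h4.trans ?_⟩
    · gcongr
    · gcongr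
  intro 𝒯 ℬ h𝒯 h𝒯card hℬ hℬcard ε η hε hη hη1
  have hP : ∀ M₁ M₂ : GrayImage n, δ ≤ δ / n * max M₁.perimeter M₂.perimeter := fun M₁ M₂ =>
    calc δ = δ / n * n := by field_simp
      _ ≤ _ := mul_le_mul_of_nonneg_left (M₁.le_perimeter.trans (le_max_left _ _)) (by positivity)
  have h𝒯0 := h𝒯.nonempty hc hn
  have hℬ0 := hℬ.nonempty hc
  -- Here the error bound is at least 1, so a constant output without queries is good enough.
  by_cases htriv : 1 / (16 * c) < δ ∨ 1 < ε
  · obtain ⟨T, hT⟩ := h𝒯0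
    obtain ⟨L, hL⟩ := hℬ0
    refine ⟨PMF.pure (.output (T, L)), ?_, fun M₁ M₂ => ?_⟩
    · intro a ha M₁ M₂
      rw [PMF.mem_support_pure_iff] at ha
      have h1 : 0 ≤ Real.log (2 / η) := Real.log_nonneg (by rw [le_div_iff₀ hη]; linarith)
      have h2 : 0 ≤ Real.log (2 + 1 / (ε * δ)) := Real.log_nonneg (by
        have : 0 < 1 / (ε * δ) := by positivity
        linarith)
      rw [ha, QueryAlg.queryCount, Nat.cast_zero]
      positivity
    · have hδP := hP M₁ M₂
      have h1 := abs_imageDistWith_sub_imageDist_le_one hc (h𝒯.1 T hT) (hℬ.1 L hL) M₁ M₂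
      have h2 : 1 ≤ (Q + 16 * c + 2) * (δ + ε) := by
        rcases htriv with h | h
        · rw [div_lt_iff₀ (by positivity)] at h
          nlinarith [mul_pos hε (by linarith : 0 < c), mul_nonneg hQ hδ.le, mul_nonneg hQ hε.le]
        · nlinarith [mul_pos hδ (by linarith : 0 < c), mul_nonneg hQ hδ.le, mul_nonneg hQ hε.le]
      rw [PMF.toOuterMeasure_pure_apply, if_pos]
      · rw [ENNReal.ofReal_le_one]
        linarith
      · refine ⟨hT, hL, h1.trans (h2.trans ?_)⟩
        gcongr
  · push Not at htriv
    obtain ⟨hδc, hε1⟩ := htriv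
    have hδ1 : δ ≤ 1 := hδc.trans (by rw [div_le_one (by positivity)]; linarith)
    have hmax : ∀ d : ℕ, max 1 (1 / δ ^ d) = 1 / δ ^ d := fun d =>
      max_eq_right ((one_le_div (by positivity)).2 (pow_le_one₀ hδ.le hδ1))
    rw [hmax] at h𝒯card hℬcard
    set m := ⌈4 / ε ^ 2 * Real.log (2 * ((𝒯.card : ℝ) * ℬ.card) / η)⌉₊ with hmdef
    have : Nonempty (Pixel n) := by
      rw [← Fintype.card_pos_iff, card_pixel]
      positivity
    choose a ha using fun x : Fin m → Pixel n =>
      exists_queryAlg_minimizing_sampleMismatch h𝒯0 hℬ0 x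
    refine ⟨(PMF.uniformOfFintype (Fin m → Pixel n)).map a, ?_, fun M₁ M₂ => ?_⟩
    · intro b hb M₁ M₂
      obtain ⟨x, -, rfl⟩ := (PMF.mem_support_map_iff _ _ _).1 hb
      refine le_trans ?_ (sampleSize_mul_le hB1 hε hε1 hδ hδ1 hη hη1
        (by exact_mod_cast h𝒯0.card_pos) h𝒯card (by exact_mod_cast hℬ0.card_pos) hℬcard)
      have h : ((a x).queryCount M₁ M₂ : ℝ) ≤ m * (1 + 𝒯.card) := by
        exact_mod_cast (ha x M₁ M₂).1
      exact h
    · refine ofReal_one_sub_le_toOuterMeasure_map_uniform a _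
        (Finset.univ.filter fun x : Fin m → Pixel n => ∃ j ∈ 𝒯 ×ˢ ℬ,
          m * ε ≤ |sampleMismatch x M₁ M₂ j - m * imageDistWith j.1 j.2 M₁ M₂|) ?_ ?_
      · have h := card_exists_sample_mean_far_le (𝒯 ×ˢ ℬ)
          (fun j (p : Pixel n) => mismatch j.2 M₂ (M₁ p) (imageAffine j.1 p.1))
          (fun j p => ⟨mismatch_nonneg _ _ _ _, mismatch_le_one _ _ (M₁ p).2 _⟩)
          (μ := fun j => imageDistWith j.1 j.2 M₁ M₂)
          (fun j => by
            rw [imageDistWith_eq, card_pixel]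
            push_cast
            field_simp) hε hε1 hη (m := m) (h𝒯0.product hℬ0)
          (by rw [Finset.card_product, Nat.cast_mul]; exact Nat.le_ceil _)
        rw [Fintype.card_fun, Fintype.card_fin]
        push_cast
        exact h
      · intro x hx
        have hx' : ∀ j ∈ 𝒯 ×ˢ ℬ,
            |sampleMismatch x M₁ M₂ j - m * imageDistWith j.1 j.2 M₁ M₂| < m * ε := by
          intro j hj
          by_contra h
          exact hx (Finset.mem_filter.2 ⟨Finset.mem_univ _, j, hj, not_lt.1 h⟩)
        obtain ⟨-, hmem, hmin⟩ := ha x M₁ M₂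
        obtain ⟨hmT, hmL⟩ := Finset.mem_product.1 hmem
        refine ⟨hmT, hmL, ?_⟩
        set r := (a x).run M₁ M₂
        have hm0 : (0 : ℝ) < m :=
          pos_of_mul_pos_left ((abs_nonneg _).trans_lt (hx' r hmem)) hε.le
        -- One `ε` is lost in estimating the returned pair and one in estimating its competitor.
        have hbest : ∀ j ∈ 𝒯 ×ˢ ℬ, imageDistWith r.1 r.2 M₁ M₂ ≤
            imageDistWith j.1 j.2 M₁ M₂ + 2 * ε := by
          intro j hj
          have h1 := (abs_lt.1 (hx' r hmem)).1
          have h2 := (abs_lt.1 (hx' j hj)).2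
          have h3 := hmin j hj
          refine le_of_mul_le_mul_left ?_ hm0
          linarith
        have hP2 : δ / n * M₂.perimeter ≤ δ / n * max M₁.perimeter M₂.perimeter :=
          mul_le_mul_of_nonneg_left (le_max_right _ _) (by positivity)
        have hlow := imageDist_le (h𝒯.1 _ hmT) (hℬ.1 _ hmL) M₁ M₂
        have hup : imageDistWith r.1 r.2 M₁ M₂ - (Q * (δ / n * M₂.perimeter) + 2 * ε) ≤
            imageDist c M₁ M₂ := by
          refine le_imageDist hc fun T hT L hL => ?_
          obtain ⟨T', hT', L', hL', h⟩ :=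
            exists_mem_covers_imageDistWith_le hc hδc hδ hδn h𝒯 hℬ M₁ M₂ hT hL
          have := hbest (T', L') (Finset.mem_product.2 ⟨hT', hL'⟩)
          linarith
        rw [abs_of_nonneg (by linarith)]
        have hPpos := hδ.le.trans (hP M₁ M₂)
        have h1 := mul_le_mul_of_nonneg_left hP2 hQ
        have h2 : 0 ≤ (16 * c + 2) * (δ / n * max M₁.perimeter M₂.perimeter) :=
          mul_nonneg (by linarith) hPpos
        have h3 : 0 ≤ (Q + 16 * c) * ε := by positivity
        linarith
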